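/- Let $\mathcal H$ be a separable real or complex Hilbert space with orthonormal basis $(b_j)$, let $n\ge 2$ and $k\ge 1$ be integers, and let $\mathbb X_1,\dots,\mathbb X_{nk}$ be random self-adjoint Hilbert–Schmidt operators on $\mathcal H$ with $\mathbb E\|\mathbb X_i\|_{\mathrm{HS}}^2<\infty$, not all almost surely $0$. Suppose that the sequence is $k$-gap independent, that is, for every $m$ the $\sigma$-algebras $\sigma(\mathbb X_j : j\le m)$ and $\sigma(\mathbb X_j : j\ge m+k)$ are independent, and that there is a constant $M>0$ such that for all $i$ $$\mathbb E[\mathbb X_i]=\mathbf 0\quad\text{and}\quad \lambda_{\max}(\mathbb X_i)\le M\ \text{ almost surely},$$ where $\lambda_{\max}(A)=\sup_{x\neq 0}\langle Ax,x\rangle/\|x\|^2$. Put $$v^2=\sup_{\emptyset\neq K\subseteq\{1,\dots,nk\}}\frac1{\mathrm{Card}\,K}\,\lambda_{\max}\Big(\mathbb E\Big[\Big(\sum_{i\in K}\mathbb X_i\Big)^2\Big]\Big),\qquad \mathrm{intd}=\max_{i}\ \mathrm{intdim}\big(\mathbb E[\mathbb X_i^2]\big),$$ where $\mathrm{intdim}(A)=\mathrm{tr}(A)/\|A\|$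 for $A\ne 0$ and $\mathrm{intdim}(0)=0$ (so $\mathrm{intd}=\mathrm{intdim}(\mathbb E\mathbb X^2)$ if the second moment $\mathbb E[\mathbb X_i^2]=\mathbb E\mathbb X^2$ is the same for all $i$). Let $t>0$ satisfy $tM<\frac1k\cdot\frac1{\log n}$, and write $Y=\exp\big(t\sum_{i=1}^{nk}\mathbb X_i\big)-\mathbf I$ and $$R=\log n\,\log 3+\log\Big(\frac{nk}2\,\mathrm{intd}\Big)+t^2nkv^2\,\frac{169}{1-tMk\log n}.$$ Then: 1. $\mathbb E[Y]$ is a positive operator of trace class and $\log \mathrm{tr}\,\mathbb E[Y]\le R$. 2. If $Y$ has integrable trace norm, $\mathbb E\|Y\|_1<\infty$ (which is automatic if $\dim\mathcal H<\infty$), then $\mathrm{tr}(Y)$ is integrable and $$\log\mathbb E\,\mathrm{tr}\Big(\exp\Big(t\sum_{i=1}^{nk}\mathbb X_i\Big)-\mathbf I\Big)\le R .$$ In both parts the logarithm on the left is read as $0$ if its argument is $0$. -/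

import Mathlib

open MeasureTheory ProbabilityTheory

noncomputable section

/-- The squared Hilbert-Schmidt norm `‖A‖_HS² ∈ [0, ∞]`: the supremum of `∑ ‖A e_i‖²` over all
finite orthonormal families (equal to `∑ ‖A b_i‖²` for any Hilbert basis `b`). -/
def hsNormSq {𝕜 H : Type*} [RCLike 𝕜] [NormedAddCommGroup H] [InnerProductSpace 𝕜 H]
    (A : H →L[𝕜] H) : ENNReal :=
  ⨆ (m : ℕ) (e : Fin m → H) (_ : Orthonormal 𝕜 e), ∑ i, ‖A (e i)‖ₑ ^ 2

/-- The trace norm `‖A‖₁ = tr |A| ∈ [0, ∞]`, in its variational form: the supremum of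
`∑ |⟪f_i, A e_i⟫|` over all pairs of finite orthonormal families `e`, `f`.
`A` is of trace class exactly if this is finite. -/
def traceNorm {𝕜 H : Type*} [RCLike 𝕜] [NormedAddCommGroup H] [InnerProductSpace 𝕜 H]
    (A : H →L[𝕜] H) : ENNReal :=
  ⨆ (m : ℕ) (e : Fin m → H) (f : Fin m → H) (_ : Orthonormal 𝕜 e) (_ : Orthonormal 𝕜 f),
    ∑ i, ‖inner 𝕜 (f i) (A (e i))‖ₑ

/-- The trace `∑ ⟪b_i, A b_i⟫` of a self-adjoint operator, computed in the Hilbert basis `b`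
(for self-adjoint `A` the summands are real). For operators of trace class and for positive
operators the sum does not depend on `b`. -/
def opTrace {ι 𝕜 H : Type*} [RCLike 𝕜] [NormedAddCommGroup H] [InnerProductSpace 𝕜 H]
    (b : HilbertBasis ι 𝕜 H) (A : H →L[𝕜] H) : ℝ :=
  ∑' i, RCLike.re (inner 𝕜 (b i) (A (b i)))

/-- The top of the spectrum of a self-adjoint operator, as the supremum of its Rayleigh quotient
over the nonzero vectors. -/
def lambdaMax {𝕜 H : Type*} [RCLike 𝕜] [NormedAddCommGroup H] [InnerProductSpace 𝕜 H]
    (A : H →L[𝕜] H) : ℝ :=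
  ⨆ x : {x : H // x ≠ 0}, A.rayleighQuotient x

/-- The intrinsic dimension `tr A / ‖A‖` of a nonzero positive operator of trace class. -/
def intdim {ι 𝕜 H : Type*} [RCLike 𝕜] [NormedAddCommGroup H] [InnerProductSpace 𝕜 H]
    (b : HilbertBasis ι 𝕜 H) (A : H →L[𝕜] H) : ℝ :=
  opTrace b A / ‖A‖

/-- `k`-gap independence of a finite sequence: for each `m`, the `σ`-algebra generated by the
variables with index at most `m` is independent of the one generated by the variables with index
at least `m + k`. -/
def GapIndependent {Ω E : Type*} [MeasurableSpace Ω] [MeasurableSpace E] {N : ℕ} (k : ℕ)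
    (X : Fin N → Ω → E) (μ : Measure Ω) : Prop :=
  ∀ m : ℕ, Indep
    (⨆ (j : Fin N) (_ : (j : ℕ) ≤ m), MeasurableSpace.comap (X j) inferInstance)
    (⨆ (j : Fin N) (_ : m + k ≤ (j : ℕ)), MeasurableSpace.comap (X j) inferInstance) μ

/-- `v² = sup_K (1 / Card K) λ_max (E [(∑_{i ∈ K} X_i)²])`, over the nonempty sets `K` of
indices. -/
def blockVariance {Ω 𝕜 H : Type*} [MeasurableSpace Ω] [RCLike 𝕜] [NormedAddCommGroup H]
    [InnerProductSpace 𝕜 H] [NormedSpace ℝ H] [IsScalarTower ℝ 𝕜 H] {N : ℕ}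
    (X : Fin N → Ω → H →L[𝕜] H) (μ : Measure Ω) : ℝ :=
  ⨆ K : {K : Finset (Fin N) // K.Nonempty},
    1 / (K.1.card : ℝ) * lambdaMax (∫ ω, (∑ i ∈ K.1, X i ω) ^ 2 ∂μ)

/-- `intd = max_i intdim (E [X_i²])`; this is `intdim (E [X²])` if the second moment `E [X_i²]`
does not depend on `i`, in particular for identically distributed `X_i`. -/
def seqIntdim {Ω ι 𝕜 H : Type*} [MeasurableSpace Ω] [RCLike 𝕜] [NormedAddCommGroup H]
    [InnerProductSpace 𝕜 H] [NormedSpace ℝ H] [IsScalarTower ℝ 𝕜 H] {N : ℕ}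
    (b : HilbertBasis ι 𝕜 H) (X : Fin N → Ω → H →L[𝕜] H) (μ : Measure Ω) : ℝ :=
  ⨆ i : Fin N, intdim b (∫ ω, X i ω ^ 2 ∂μ)

end

/-!
Split the indices into `n` consecutive blocks of length `k`. By gap independence, every block is
independent of the preceding blocks of the same parity, so the sum is the half-sum of twice the sum
of the even blocks and twice the sum of the odd blocks, each of which is a sum of independent
centred operators bounded above by `k M`. The trace of the exponential of a half-sum is at most the
mean of the two traces (`finTrace_exp_add_le_half_add`), which costs only a factor `2` in `t`.

For independent blocks the trace moment is estimated one block at a time, with the Golden-Thompson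
inequality `tr exp (S + A) ≤ tr (exp S exp A)` (`finTrace_exp_add_le`). Taking expectations, and
using `0 ≤ exp A - 1 - A ≤ (exp c / 2) A²` for `A ≤ c` (`re_inner_exp_sub_one_sub`), the excess
`a = E tr exp S - tr 1` obeys the recursion `a' ≤ (1 + φ λ) a + φ ρ` with `φ = exp c / 2`, where
`λ` bounds the block variance and `ρ` its trace (`IsCenteredBlock.integral_finTrace_exp_add_le`).
The definition of `v²` as a supremum over all index sets gives `λ ≤ (2 t)² k v²`, and `ρ` is
controlled by `k` times the same quantity times the intrinsic dimension. Since the recursion starts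
at `0`, no dimension enters except through `ρ`; since `t M k < 1 / log 2`, the resulting exponent is
below `169 t² n k v²` (`recursion_bound_le`).

The Golden-Thompson inequality follows from the Lie product formula and from
`τ ((X Y)^(2^j)) ≤ τ (X^(2^j) Y^(2^j))`, which holds for every positive tracial functional on a star
ring (`tracial_pow_two_pow_le`). In infinite dimension it is applied to the compressions `P X_i P`
by finite-dimensional coordinate projections, which are again centred, gap independent and bounded
above, with the partial trace over the range of `P`. As the operators are Hilbert-Schmidt, the
compressions converge in norm (`tendsto_compress`) and the partial traces of `E [exp (t S)] - 1`
inherit the bound (`IsCenteredFamily.sum_re_inner_integral_exp_le`). This operator is positive since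
`exp A - 1 - A` is and `S` is centred. If the trace norm is integrable, expectation and trace
commute by Fubini's theorem.
-/

/-! ### Trace inequalities in star rings -/

section TracialFunctional

lemma mul_pow_succ_eq {A : Type*} [Ring A] (a b : A) (m : ℕ) : (a * b) ^ (m + 1) = a * ((b * a) ^ m * b) := by
  induction m with
  | zero => simp
  | succ m ih => rw [pow_succ', ih, pow_succ' (b * a)]; noncomm_ring

variable {A : Type*} [Ring A] [StarRing A] {τ : A →+ ℝ}

lemma tracial_pow_mul_comm {A : Type*} [Ring A] {τ : A →+ ℝ} (hc : ∀ a b, τ (a * b) = τ (b * a))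
    (a b : A) (m : ℕ) :
    τ ((a * b) ^ m) = τ ((b * a) ^ m) := by
  cases m with
  | zero => simp
  | succ m => rw [mul_pow_succ_eq, hc, mul_assoc, ← pow_succ]

lemma tracial_mul_le_half_add (hc : ∀ a b, τ (a * b) = τ (b * a))
    (hp : ∀ a, 0 ≤ τ (star a * a)) {x y : A} (hx : IsSelfAdjoint x) (hy : IsSelfAdjoint y) :
    τ (x * y) ≤ (τ (x * x) + τ (y * y)) / 2 := by
  have h := hp (x - y)
  have e : star (x - y) * (x - y) = x * x + y * y - x * y - y * x := by
    rw [star_sub, hx.star_eq, hy.star_eq]; noncomm_ring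
  rw [e, map_sub, map_sub, map_add, hc y x] at h
  linarith

/-- The trace inequalities `τ (C^(2^(j+1))) ≤ τ ((C⋆ C)^(2^j))` and
`τ ((X Y)^(2^j)) ≤ τ (X^(2^j) Y^(2^j))` are proved together: the second one at level `j + 1` is the
first one for `C = X Y` followed by the second one for `X²`, `Y²`, and the first one at level
`j + 1` is the first one for `C²` followed by the second one for `C⋆ C`, `C C⋆`. -/
lemma tracial_pow_two_pow_le (hc : ∀ a b, τ (a * b) = τ (b * a)) (hs : ∀ a, τ (star a) = τ a)
    (hp : ∀ a, 0 ≤ τ (star a * a)) (j : ℕ) :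
    (∀ C : A, τ (C ^ 2 ^ (j + 1)) ≤ τ ((star C * C) ^ 2 ^ j)) ∧
    ∀ X Y : A, IsSelfAdjoint X → IsSelfAdjoint Y →
      τ ((X * Y) ^ 2 ^ j) ≤ τ (X ^ 2 ^ j * Y ^ 2 ^ j) := by
  induction j with
  | zero =>
    refine ⟨fun C => ?_, fun X Y _ _ => by simp⟩
    have h := hp (C - star C)
    have e : star (C - star C) * (C - star C)
        = star C * C + C * star C - C * C - star (C * C) := by
      rw [star_sub, star_star, star_mul]; noncomm_ring
    rw [e, map_sub, map_sub, map_add, hs, hc C (star C)] at h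
    simp only [zero_add, pow_one, pow_zero, pow_two]
    linarith
  | succ j ih =>
    obtain ⟨ihQ, ihP⟩ := ih
    refine ⟨fun C => ?_, fun X Y hX hY => ?_⟩
    · have h1 : C ^ 2 ^ (j + 1 + 1) = (C ^ 2) ^ 2 ^ (j + 1) := by
        rw [← pow_mul]; congr 1; ring
      have h2 : star (C ^ 2) * C ^ 2 = star C * ((star C * C) * C) := by
        rw [star_pow]; noncomm_ring
      have h3 : (star C * C) * C * star C = (star C * C) * (C * star C) := by noncomm_ring
      have hsa : IsSelfAdjoint (star C * C) := IsSelfAdjoint.star_mul_self C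
      have hsa' : IsSelfAdjoint (C * star C) := IsSelfAdjoint.mul_star_self C
      have hsq : ∀ x : A, x ^ 2 ^ j * x ^ 2 ^ j = x ^ 2 ^ (j + 1) := fun x => by
        rw [← pow_add]; congr 1; ring
      calc τ (C ^ 2 ^ (j + 1 + 1)) = τ ((C ^ 2) ^ 2 ^ (j + 1)) := by rw [h1]
        _ ≤ τ ((star (C ^ 2) * C ^ 2) ^ 2 ^ j) := ihQ _
        _ = τ (((star C * C) * (C * star C)) ^ 2 ^ j) := by
            rw [h2, tracial_pow_mul_comm hc, h3]
        _ ≤ τ ((star C * C) ^ 2 ^ j * (C * star C) ^ 2 ^ j) := ihP _ _ hsa hsa'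
        _ ≤ (τ ((star C * C) ^ 2 ^ (j + 1)) + τ ((C * star C) ^ 2 ^ (j + 1))) / 2 := by
            have := tracial_mul_le_half_add hc hp (hsa.pow (2 ^ j)) (hsa'.pow (2 ^ j))
            rwa [hsq, hsq] at this
        _ = τ ((star C * C) ^ 2 ^ (j + 1)) := by
            rw [tracial_pow_mul_comm hc C (star C)]; ring
    · have h2 : star (X * Y) * (X * Y) = Y * (X ^ 2 * Y) := by
        rw [star_mul, hX.star_eq, hY.star_eq]; noncomm_ring
      have h3 : X ^ 2 * Y * Y = X ^ 2 * Y ^ 2 := by noncomm_ring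
      calc τ ((X * Y) ^ 2 ^ (j + 1)) ≤ τ ((star (X * Y) * (X * Y)) ^ 2 ^ j) := ihQ _
        _ = τ ((X ^ 2 * Y ^ 2) ^ 2 ^ j) := by rw [h2, tracial_pow_mul_comm hc, h3]
        _ ≤ τ ((X ^ 2) ^ 2 ^ j * (Y ^ 2) ^ 2 ^ j) := ihP _ _ (hX.pow 2) (hY.pow 2)
        _ = τ (X ^ 2 ^ (j + 1) * Y ^ 2 ^ (j + 1)) := by
            rw [← pow_mul, ← pow_mul, pow_succ' 2 j]

end TracialFunctional

/-! ### The Lie product formula -/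

section LieProduct

variable {A : Type*} [NormedRing A]

lemma norm_pow_sub_pow_le {r : ℝ} {x y : A} (hx : ‖x‖ ≤ r)
    (hy : ‖y‖ ≤ r) (m : ℕ) : ‖x ^ (m + 1) - y ^ (m + 1)‖ ≤ (m + 1) * r ^ m * ‖x - y‖ := by
  have hr : 0 ≤ r := (norm_nonneg x).trans hx
  induction m with
  | zero => simp
  | succ m ih =>
    have e : x ^ (m + 1 + 1) - y ^ (m + 1 + 1)
        = x * (x ^ (m + 1) - y ^ (m + 1)) + (x - y) * y ^ (m + 1) := by
      rw [pow_succ' x, pow_succ' y (m + 1)]; noncomm_ring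
    have hym : ‖y ^ (m + 1)‖ ≤ r ^ (m + 1) :=
      (norm_pow_le' y m.succ_pos).trans (pow_le_pow_left₀ (norm_nonneg _) hy _)
    calc ‖x ^ (m + 1 + 1) - y ^ (m + 1 + 1)‖
        ≤ ‖x‖ * ‖x ^ (m + 1) - y ^ (m + 1)‖ + ‖x - y‖ * ‖y ^ (m + 1)‖ := by
          rw [e]; exact (norm_add_le _ _).trans (add_le_add (norm_mul_le _ _) (norm_mul_le _ _))
      _ ≤ r * ((m + 1) * r ^ m * ‖x - y‖) + ‖x - y‖ * r ^ (m + 1) := by gcongr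
      _ = (((m + 1 : ℕ) : ℝ) + 1) * r ^ (m + 1) * ‖x - y‖ := by push_cast; ring

variable [NormedAlgebra ℝ A]

lemma norm_exp_le_exp_norm (h1 : ‖(1 : A)‖ ≤ 1) (a : A) :
    ‖NormedSpace.exp a‖ ≤ Real.exp ‖a‖ := by
  rw [NormedSpace.exp_eq_tsum ℝ, Real.exp_eq_exp_ℝ, NormedSpace.exp_eq_tsum ℝ]
  refine tsum_of_norm_bounded (NormedSpace.expSeries_summable' (𝕂 := ℝ) ‖a‖).hasSum fun n => ?_
  rw [norm_smul, smul_eq_mul, Real.norm_of_nonneg (by positivity)]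
  gcongr
  rcases n with _ | n
  · simpa using h1
  · exact norm_pow_le' a n.succ_pos

/-- The Lie product formula along the exponents `2^j`. -/
lemma tendsto_lie_product [CompleteSpace A] (h1 : ‖(1 : A)‖ ≤ 1) (a b : A) :
    Filter.Tendsto (fun j : ℕ => (NormedSpace.exp (((2 : ℝ) ^ j)⁻¹ • a)
      * NormedSpace.exp (((2 : ℝ) ^ j)⁻¹ • b)) ^ 2 ^ j) Filter.atTop
      (nhds (NormedSpace.exp (a + b))) := by
  let : NormedAlgebra ℚ A := .restrictScalars ℚ ℝ A
  set f : ℝ → A := fun u => NormedSpace.exp (u • a) * NormedSpace.exp (u • b) with hf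
  set g : ℝ → A := fun u => NormedSpace.exp (u • (a + b)) with hg
  have hder : HasDerivAt (fun u => f u - g u) 0 0 := by
    have ha := hasDerivAt_exp_smul_const (𝕂 := ℝ) a 0
    have hb := hasDerivAt_exp_smul_const (𝕂 := ℝ) b 0
    have hab := hasDerivAt_exp_smul_const (𝕂 := ℝ) (a + b) 0
    exact ((ha.mul hb).sub hab).congr_deriv (by simp)
  have hlittle : (fun u => f u - g u) =o[nhds 0] (fun u : ℝ => u) := by
    have := hder.isLittleO
    simpa [hf, hg] using this
  have hu : Filter.Tendsto (fun j : ℕ => ((2 : ℝ) ^ j)⁻¹) Filter.atTop (nhds 0) :=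
    tendsto_inv_atTop_zero.comp (tendsto_pow_atTop_atTop_of_one_lt (by norm_num))
  have hseq := hlittle.comp_tendsto hu
  have hzero : Filter.Tendsto (fun j : ℕ => (2 : ℝ) ^ j
      * ‖f (((2 : ℝ) ^ j)⁻¹) - g (((2 : ℝ) ^ j)⁻¹)‖) Filter.atTop (nhds 0) := by
    have := (Asymptotics.isLittleO_iff_tendsto' (Filter.Eventually.of_forall fun j h => by
      simp at h)).1 hseq.norm_left
    refine this.congr fun j => ?_
    simp [div_eq_mul_inv, mul_comm]
  have hgN : ∀ j : ℕ, g (((2 : ℝ) ^ j)⁻¹) ^ 2 ^ j = NormedSpace.exp (a + b) := fun j => by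
    rw [hg, ← NormedSpace.exp_nsmul, ← Nat.cast_smul_eq_nsmul ℝ, smul_smul]
    simp
  rw [tendsto_iff_norm_sub_tendsto_zero]
  have hbd := hzero.const_mul (Real.exp (‖a‖ + ‖b‖))
  rw [mul_zero] at hbd
  refine squeeze_zero (fun _ => norm_nonneg _) (fun j => ?_) hbd
  set u : ℝ := ((2 : ℝ) ^ j)⁻¹ with hudef
  have hupos : 0 ≤ u := by positivity
  set r : ℝ := Real.exp (u * (‖a‖ + ‖b‖)) with hr
  have hfr : ‖f u‖ ≤ r := by
    refine (norm_mul_le _ _).trans ?_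
    refine (mul_le_mul (norm_exp_le_exp_norm h1 _) (norm_exp_le_exp_norm h1 _) (norm_nonneg _)
      (Real.exp_nonneg _)).trans ?_
    rw [← Real.exp_add, norm_smul, norm_smul, Real.norm_of_nonneg hupos, ← mul_add]
  have hgr : ‖g u‖ ≤ r := by
    refine (norm_exp_le_exp_norm h1 _).trans (Real.exp_le_exp.2 ?_)
    rw [norm_smul, Real.norm_of_nonneg hupos]
    gcongr
    exact norm_add_le _ _
  obtain ⟨m, hm⟩ : ∃ m, 2 ^ j = m + 1 := ⟨2 ^ j - 1, by have := Nat.one_le_two_pow (n := j); omega⟩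
  have hm' : (2 : ℝ) ^ j = m + 1 := by exact_mod_cast hm
  have hrm : r ^ m ≤ Real.exp (‖a‖ + ‖b‖) := by
    rw [hr, ← Real.exp_nat_mul]
    refine Real.exp_le_exp.2 ?_
    have : (m : ℝ) * u ≤ 1 := by
      rw [hudef, hm', ← div_eq_mul_inv]
      exact (div_le_one (by positivity)).2 (by linarith)
    calc (m : ℝ) * (u * (‖a‖ + ‖b‖)) = (m * u) * (‖a‖ + ‖b‖) := by ring
      _ ≤ 1 * (‖a‖ + ‖b‖) := by gcongr
      _ = _ := one_mul _
  rw [← hgN j, ← hudef, hm]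
  calc ‖f u ^ (m + 1) - g u ^ (m + 1)‖ ≤ (m + 1) * r ^ m * ‖f u - g u‖ :=
        norm_pow_sub_pow_le hfr hgr m
    _ ≤ (m + 1) * Real.exp (‖a‖ + ‖b‖) * ‖f u - g u‖ := by gcongr
    _ = Real.exp (‖a‖ + ‖b‖) * ((2 : ℝ) ^ j * ‖f u - g u‖) := by rw [hm']; ring

end LieProduct

/-! ### Exponentials of self-adjoint operators -/

section Taylor

lemma add_deriv_le_of_deriv2_nonneg {f f' f'' : ℝ → ℝ} (hf : ∀ u, HasDerivAt f (f' u) u)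
    (hf' : ∀ u, HasDerivAt f' (f'' u) u) (h : ∀ u ∈ Set.Icc (0 : ℝ) 1, 0 ≤ f'' u) :
    f 0 + f' 0 ≤ f 1 := by
  have h1 : MonotoneOn f' (Set.Icc 0 1) :=
    monotoneOn_of_hasDerivWithinAt_nonneg (convex_Icc 0 1)
      (fun u _ => (hf' u).continuousAt.continuousWithinAt)
      (fun u _ => (hf' u).hasDerivWithinAt) fun u hu => h u (interior_subset hu)
  have h2 : MonotoneOn (fun u => f u - u * f' 0) (Set.Icc 0 1) := by
    have hd : ∀ u, HasDerivAt (fun u => f u - u * f' 0) (f' u - f' 0) u := fun u => by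
      exact ((hf u).sub ((hasDerivAt_id u).mul_const (f' 0))).congr_deriv (by simp)
    refine monotoneOn_of_hasDerivWithinAt_nonneg (convex_Icc 0 1)
      (fun u _ => (hd u).continuousAt.continuousWithinAt)
      (fun u _ => (hd u).hasDerivWithinAt) fun u hu => ?_
    have hu' := interior_subset hu
    exact sub_nonneg.2 (h1 (by simp) hu' hu'.1)
  have := h2 (by simp) (by simp) (zero_le_one' ℝ)
  simp only [zero_mul, sub_zero, one_mul] at this
  linarith

lemma taylor_two_le {f f' f'' : ℝ → ℝ} {K : ℝ} (hf : ∀ u, HasDerivAt f (f' u) u)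
    (hf' : ∀ u, HasDerivAt f' (f'' u) u) (h : ∀ u ∈ Set.Icc (0 : ℝ) 1, f'' u ≤ K) :
    f 1 ≤ f 0 + f' 0 + K / 2 := by
  have := add_deriv_le_of_deriv2_nonneg (f := fun u => K / 2 * u ^ 2 - f u)
    (f' := fun u => K * u - f' u) (f'' := fun u => K - f'' u)
    (fun u => by
      refine (((hasDerivAt_pow 2 u).const_mul (K / 2)).sub (hf u)).congr_deriv ?_
      simp; ring)
    (fun u => by
      refine (((hasDerivAt_id u).const_mul K).sub (hf' u)).congr_deriv ?_
      simp)
    fun u hu => sub_nonneg.2 (h u hu)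
  norm_num at this
  linarith

end Taylor

section Operators

variable {𝕜 H : Type*} [RCLike 𝕜] [NormedAddCommGroup H] [InnerProductSpace 𝕜 H]
  [NormedSpace ℝ H] [IsScalarTower ℝ 𝕜 H]

/-- The bounded operators on a Hilbert space over `𝕜` as a real normed algebra, compatible with
the real vector space structure coming from a given one on `H`. -/
noncomputable instance operatorNormedAlgebraReal : NormedAlgebra ℝ (H →L[𝕜] H) where
  norm_smul_le := norm_smul_le

/-- The real linear functional `a ↦ re ⟪x, a y⟫` on bounded operators. -/
noncomputable def reInnerCLM (x y : H) : (H →L[𝕜] H) →L[ℝ] ℝ :=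
  RCLike.reCLM ∘L ((innerSL 𝕜 x) ∘L (ContinuousLinearMap.apply 𝕜 H y)).restrictScalars ℝ

@[simp]
lemma reInnerCLM_apply (x y : H) (a : H →L[𝕜] H) :
    reInnerCLM x y a = RCLike.re (inner 𝕜 x (a y)) := rfl

lemma IsSelfAdjoint.inner_apply_left {𝕜 H : Type*} [RCLike 𝕜] [NormedAddCommGroup H]
    [InnerProductSpace 𝕜 H] [CompleteSpace H] {a : H →L[𝕜] H} (ha : IsSelfAdjoint a) (x y : H) :
    inner 𝕜 (a x) y = inner 𝕜 x (a y) := ha.isSymmetric x y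

lemma re_inner_mul_self {𝕜 H : Type*} [RCLike 𝕜] [NormedAddCommGroup H]
    [InnerProductSpace 𝕜 H] [CompleteSpace H] {a : H →L[𝕜] H} (ha : IsSelfAdjoint a) (x : H) :
    RCLike.re (inner 𝕜 x ((a * a) x)) = ‖a x‖ ^ 2 := by
  rw [mul_apply_eq_comp, ← ha.inner_apply_left, inner_self_eq_norm_sq]

variable [CompleteSpace H]

lemma IsSelfAdjoint.real_smul {a : H →L[𝕜] H} (ha : IsSelfAdjoint a) (u : ℝ) :
    IsSelfAdjoint (u • a) := by
  have : u • a = (u : 𝕜) • a := by ext x; simp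
  rw [this]
  exact IsSelfAdjoint.smul (by simp [isSelfAdjoint_iff]) ha

lemma hasDerivAt_re_inner_exp (a : H →L[𝕜] H) (x y : H) (u : ℝ) :
    HasDerivAt (fun u : ℝ => RCLike.re (inner 𝕜 x (NormedSpace.exp (u • a) y)))
      (RCLike.re (inner 𝕜 x (NormedSpace.exp (u • a) (a y)))) u :=
  (reInnerCLM (𝕜 := 𝕜) x y).hasFDerivAt.comp_hasDerivAt u
    (hasDerivAt_exp_smul_const (𝕂 := ℝ) a u)

lemma exp_smul_eq_half_mul_half (a : H →L[𝕜] H) (u : ℝ) :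
    NormedSpace.exp (u • a) = NormedSpace.exp ((u / 2) • a) * NormedSpace.exp ((u / 2) • a) := by
  let : NormedAlgebra ℚ (H →L[𝕜] H) := .restrictScalars ℚ ℝ _
  rw [← NormedSpace.exp_add_of_commute (Commute.refl _), ← add_smul, add_halves]

lemma re_inner_exp_smul {a : H →L[𝕜] H} (ha : IsSelfAdjoint a) (u : ℝ) (x : H) :
    RCLike.re (inner 𝕜 x (NormedSpace.exp (u • a) x)) = ‖NormedSpace.exp ((u / 2) • a) x‖ ^ 2 := by
  rw [exp_smul_eq_half_mul_half, re_inner_mul_self (ha.real_smul _).exp]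

/-- Grönwall's inequality for `u ↦ ⟪x, exp (u a) x⟫ = ‖exp (u a / 2) x‖²`. -/
lemma re_inner_exp_smul_le {a : H →L[𝕜] H} (ha : IsSelfAdjoint a) {c : ℝ}
    (hc : ∀ x, RCLike.re (inner 𝕜 x (a x)) ≤ c * ‖x‖ ^ 2) {u : ℝ} (hu : 0 ≤ u) (x : H) :
    RCLike.re (inner 𝕜 x (NormedSpace.exp (u • a) x)) ≤ Real.exp (c * u) * ‖x‖ ^ 2 := by
  set f : ℝ → ℝ := fun u => RCLike.re (inner 𝕜 x (NormedSpace.exp (u • a) x)) with hf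
  have hder : ∀ u, HasDerivAt (fun u => Real.exp (-(c * u)) * f u)
      (Real.exp (-(c * u)) * (RCLike.re (inner 𝕜 x (NormedSpace.exp (u • a) (a x))) - c * f u))
      u := fun u => by
    have h1 : HasDerivAt (fun u : ℝ => Real.exp (-(c * u))) (Real.exp (-(c * u)) * (-c)) u := by
      simpa using (((hasDerivAt_id u).const_mul c).neg).exp
    exact (h1.mul (hasDerivAt_re_inner_exp a x x u)).congr_deriv (by simp only [hf]; ring)
  have hanti : Antitone (fun u => Real.exp (-(c * u)) * f u) := by
    refine antitone_of_hasDerivAt_nonpos hder fun u => ?_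
    refine mul_nonpos_of_nonneg_of_nonpos (Real.exp_nonneg _) (sub_nonpos.2 ?_)
    set e := NormedSpace.exp ((u / 2) • a) with he
    have hesa : IsSelfAdjoint e := (ha.real_smul _).exp
    have hcomm : Commute e a := ((Commute.refl a).smul_left (u / 2)).exp_left
    have h2 : RCLike.re (inner 𝕜 x (NormedSpace.exp (u • a) (a x)))
        = RCLike.re (inner 𝕜 (e x) (a (e x))) := by
      rw [exp_smul_eq_half_mul_half, mul_apply_eq_comp, ← he,
        hesa.inner_apply_left, ← mul_apply_eq_comp e a, hcomm.eq]
      rfl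
    rw [h2, hf]
    simp only
    rw [re_inner_exp_smul ha]
    exact hc _
  have h0 := hanti hu
  simp only [hf, mul_zero, neg_zero, Real.exp_zero, one_mul, zero_smul, NormedSpace.exp_zero,
    one_apply_eq_self, inner_self_eq_norm_sq] at h0
  calc f u = Real.exp (c * u) * (Real.exp (-(c * u)) * f u) := by
        rw [← mul_assoc, ← Real.exp_add]; simp
    _ ≤ _ := by gcongr

lemma norm_exp_le_of_re_inner_le {a : H →L[𝕜] H} (ha : IsSelfAdjoint a) {c : ℝ}
    (hc : ∀ x, RCLike.re (inner 𝕜 x (a x)) ≤ c * ‖x‖ ^ 2) :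
    ‖NormedSpace.exp a‖ ≤ Real.exp c := by
  refine ContinuousLinearMap.opNorm_le_bound _ (Real.exp_nonneg _) fun x => ?_
  have h := re_inner_exp_smul_le ha hc (u := 2) zero_le_two x
  rw [re_inner_exp_smul ha, div_self two_ne_zero, one_smul, mul_two, Real.exp_add] at h
  refine abs_le_of_sq_le_sq' ?_ (by positivity) |>.2
  calc _ ≤ _ := h
    _ = _ := by ring

lemma re_inner_exp_sub_one_sub {a : H →L[𝕜] H} (ha : IsSelfAdjoint a) (x : H) :
    0 ≤ RCLike.re (inner 𝕜 x ((NormedSpace.exp a - 1 - a) x)) ∧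
    ∀ c : ℝ, 0 ≤ c → (∀ x, RCLike.re (inner 𝕜 x (a x)) ≤ c * ‖x‖ ^ 2) →
      RCLike.re (inner 𝕜 x ((NormedSpace.exp a - 1 - a) x)) ≤ Real.exp c / 2 * ‖a x‖ ^ 2 := by
  have hsecond : ∀ u : ℝ, inner 𝕜 x (NormedSpace.exp (u • a) (a (a x)))
      = inner 𝕜 (a x) (NormedSpace.exp (u • a) (a x)) := fun u => by
    have hcomm : Commute (NormedSpace.exp (u • a)) a := ((Commute.refl a).smul_left u).exp_left
    rw [← mul_apply_eq_comp _ a, hcomm.eq, mul_apply_eq_comp,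
      ha.inner_apply_left]
  have hrw : RCLike.re (inner 𝕜 x ((NormedSpace.exp a - 1 - a) x))
      = RCLike.re (inner 𝕜 x (NormedSpace.exp ((1 : ℝ) • a) x))
        - RCLike.re (inner 𝕜 x (NormedSpace.exp ((0 : ℝ) • a) x))
        - RCLike.re (inner 𝕜 x (NormedSpace.exp ((0 : ℝ) • a) (a x))) := by
    simp [inner_sub_right]
  have hd := hasDerivAt_re_inner_exp a x x
  have hd' := hasDerivAt_re_inner_exp a x (a x)
  rw [hrw]
  refine ⟨?_, fun c hc0 hc => ?_⟩
  · have := add_deriv_le_of_deriv2_nonneg hd hd' fun u _ => by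
      rw [hsecond, re_inner_exp_smul ha]; positivity
    linarith
  · have := taylor_two_le (K := Real.exp c * ‖a x‖ ^ 2) hd hd' fun u hu => by
      rw [hsecond]
      refine (re_inner_exp_smul_le ha hc hu.1 (a x)).trans ?_
      gcongr
      exact mul_le_of_le_one_right hc0 hu.2
    linarith

end Operators

/-! ### Finite compressions and the Golden-Thompson inequality -/

section FiniteProjection

variable {ι 𝕜 H : Type*} [RCLike 𝕜] [NormedAddCommGroup H] [InnerProductSpace 𝕜 H]

/-- The orthogonal projection `∑ |v j⟩⟨v j|`, `j ∈ s`, onto the span of finitely many members of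
an orthonormal family. -/
noncomputable def finProj (𝕜 : Type*) [RCLike 𝕜] [InnerProductSpace 𝕜 H] (v : ι → H)
    (s : Finset ι) : H →L[𝕜] H :=
  ∑ j ∈ s, InnerProductSpace.rankOne 𝕜 (v j) (v j)

lemma finProj_apply (v : ι → H) (s : Finset ι) (x : H) :
    finProj 𝕜 v s x = ∑ j ∈ s, inner 𝕜 (v j) x • v j := by
  simp [finProj]

lemma finProj_apply_mem {v : ι → H} (hv : Orthonormal 𝕜 v) {s : Finset ι} {j : ι} (hj : j ∈ s) :
    finProj 𝕜 v s (v j) = v j := by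
  classical
  rw [finProj_apply, Finset.sum_eq_single j]
  · simp [inner_self_eq_norm_sq_to_K, hv.1 j]
  · intro i _ hij
    rw [hv.2 hij, zero_smul]
  · exact fun h => absurd hj h

lemma finProj_mul_self {v : ι → H} (hv : Orthonormal 𝕜 v) (s : Finset ι) :
    finProj 𝕜 v s * finProj 𝕜 v s = finProj 𝕜 v s := by
  ext x
  rw [mul_apply_eq_comp, finProj_apply v s x, map_sum]
  refine Finset.sum_congr rfl fun j hj => ?_
  rw [map_smul, finProj_apply_mem hv hj]

/-- The compression `P a P` of an operator to the span of finitely many members of an orthonormal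
family, seen as an operator on the whole space. -/
noncomputable def compress (v : ι → H) (s : Finset ι) (a : H →L[𝕜] H) : H →L[𝕜] H :=
  finProj 𝕜 v s * a * finProj 𝕜 v s

lemma compress_commute {v : ι → H} (hv : Orthonormal 𝕜 v) (s : Finset ι) (a : H →L[𝕜] H) :
    Commute (compress v s a) (finProj 𝕜 v s) := by
  have h := finProj_mul_self hv s
  unfold compress Commute SemiconjBy
  rw [mul_assoc, h, ← mul_assoc, ← mul_assoc, h]

lemma compress_sum {κ : Type*} (v : ι → H) (s : Finset ι) (K : Finset κ) (a : κ → H →L[𝕜] H) :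
    compress v s (∑ i ∈ K, a i) = ∑ i ∈ K, compress v s (a i) := by
  simp only [compress, Finset.mul_sum, Finset.sum_mul]

lemma continuous_compress (v : ι → H) (s : Finset ι) :
    Continuous (compress v s : (H →L[𝕜] H) → H →L[𝕜] H) := by
  unfold compress
  fun_prop

lemma inner_mul_apply_eq_sum_right {v : ι → H} (hv : Orthonormal 𝕜 v) {s : Finset ι}
    {a : H →L[𝕜] H} (ha : Commute a (finProj 𝕜 v s)) (b : H →L[𝕜] H) {j : ι} (hj : j ∈ s) :
    inner 𝕜 (v j) ((b * a) (v j))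
      = ∑ l ∈ s, inner 𝕜 (v j) (b (v l)) * inner 𝕜 (v l) (a (v j)) := by
  have h : a (v j) = finProj 𝕜 v s (a (v j)) := by
    conv_lhs => rw [← finProj_apply_mem hv hj]
    exact congrArg (fun c : H →L[𝕜] H => c (v j)) ha.eq
  rw [mul_apply_eq_comp, h, finProj_apply, map_sum, inner_sum]
  refine Finset.sum_congr rfl fun l hl => ?_
  rw [map_smul, inner_smul_right, mul_comm]
  congr 1
  rw [← finProj_apply, ← h]

variable [CompleteSpace H]

lemma finProj_isSelfAdjoint (v : ι → H) (s : Finset ι) : IsSelfAdjoint (finProj 𝕜 v s) := by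
  refine isSelfAdjoint_sum s fun j _ => ?_
  exact (InnerProductSpace.isPositive_rankOne_self (v j)).isSelfAdjoint

lemma norm_finProj_apply_le {v : ι → H} (hv : Orthonormal 𝕜 v) (s : Finset ι) (x : H) :
    ‖finProj 𝕜 v s x‖ ≤ ‖x‖ := by
  have h := re_inner_mul_self (finProj_isSelfAdjoint (𝕜 := 𝕜) v s) x
  rw [finProj_mul_self hv] at h
  have h2 := (RCLike.re_le_norm _).trans (norm_inner_le_norm (𝕜 := 𝕜) x (finProj 𝕜 v s x))
  rw [h, pow_two] at h2
  by_contra! hlt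
  have : 0 < ‖finProj 𝕜 v s x‖ := (norm_nonneg x).trans_lt hlt
  nlinarith

lemma compress_isSelfAdjoint (v : ι → H) (s : Finset ι) {a : H →L[𝕜] H} (ha : IsSelfAdjoint a) :
    IsSelfAdjoint (compress v s a) := by
  have h := finProj_isSelfAdjoint (𝕜 := 𝕜) v s
  unfold compress
  rw [isSelfAdjoint_iff, star_mul, star_mul, h.star_eq, ha.star_eq, mul_assoc]

lemma inner_compress (v : ι → H) (s : Finset ι) (a : H →L[𝕜] H) (x y : H) :
    inner 𝕜 x (compress v s a y) = inner 𝕜 (finProj 𝕜 v s x) (a (finProj 𝕜 v s y)) := by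
  rw [(finProj_isSelfAdjoint v s).inner_apply_left]; rfl

lemma norm_compress_apply_le {v : ι → H} (hv : Orthonormal 𝕜 v) (s : Finset ι) (a : H →L[𝕜] H)
    (x : H) : ‖compress v s a x‖ ≤ ‖a (finProj 𝕜 v s x)‖ :=
  norm_finProj_apply_le hv s _

lemma re_inner_compress_le {v : ι → H} (hv : Orthonormal 𝕜 v) (s : Finset ι) {a : H →L[𝕜] H}
    {c : ℝ} (hc0 : 0 ≤ c) (hc : ∀ x, RCLike.re (inner 𝕜 x (a x)) ≤ c * ‖x‖ ^ 2) (x : H) :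
    RCLike.re (inner 𝕜 x (compress v s a x)) ≤ c * ‖x‖ ^ 2 := by
  rw [inner_compress]
  refine (hc _).trans ?_
  gcongr
  exact norm_finProj_apply_le hv s x

lemma inner_mul_apply_eq_sum_left {v : ι → H} (hv : Orthonormal 𝕜 v) {s : Finset ι}
    {a : H →L[𝕜] H} (ha : Commute a (finProj 𝕜 v s)) (b : H →L[𝕜] H) {j : ι} (hj : j ∈ s) :
    inner 𝕜 (v j) ((a * b) (v j))
      = ∑ l ∈ s, inner 𝕜 (v j) (a (v l)) * inner 𝕜 (v l) (b (v j)) := by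
  have h : inner 𝕜 (v j) (a (b (v j))) = inner 𝕜 (v j) (a (finProj 𝕜 v s (b (v j)))) := by
    conv_lhs => rw [← finProj_apply_mem hv hj]
    rw [(finProj_isSelfAdjoint v s).inner_apply_left, ← mul_apply_eq_comp _ a, ← ha.eq,
      finProj_apply_mem hv hj]
    rfl
  rw [mul_apply_eq_comp, h, finProj_apply, map_sum, inner_sum]
  refine Finset.sum_congr rfl fun l _ => ?_
  rw [map_smul, inner_smul_right, mul_comm]

end FiniteProjection

section FiniteTrace

variable {ι 𝕜 H : Type*} [RCLike 𝕜] [NormedAddCommGroup H] [InnerProductSpace 𝕜 H]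
  [NormedSpace ℝ H] [IsScalarTower ℝ 𝕜 H]

/-- The partial trace `a ↦ ∑ re ⟪v j, a (v j)⟫`, `j ∈ s`, as a real linear functional. It is tracial
on the operators that commute with `finProj 𝕜 v s`. -/
noncomputable def finTrace (v : ι → H) (s : Finset ι) : (H →L[𝕜] H) →L[ℝ] ℝ :=
  ∑ j ∈ s, reInnerCLM (v j) (v j)

lemma finTrace_apply (v : ι → H) (s : Finset ι) (a : H →L[𝕜] H) :
    finTrace v s a = ∑ j ∈ s, RCLike.re (inner 𝕜 (v j) (a (v j))) := by
  simp [finTrace]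

variable [CompleteSpace H]

lemma finTrace_star (v : ι → H) (s : Finset ι) (a : H →L[𝕜] H) :
    finTrace v s (star a) = finTrace v s a := by
  rw [finTrace_apply, finTrace_apply]
  refine Finset.sum_congr rfl fun j _ => ?_
  rw [ContinuousLinearMap.star_eq_adjoint, ContinuousLinearMap.adjoint_inner_right, inner_re_symm]

lemma finTrace_mul_self (v : ι → H) (s : Finset ι) {a : H →L[𝕜] H} (ha : IsSelfAdjoint a) :
    finTrace v s (a * a) = ∑ j ∈ s, ‖a (v j)‖ ^ 2 := by
  rw [finTrace_apply]
  exact Finset.sum_congr rfl fun j _ => re_inner_mul_self ha _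

lemma finTrace_star_mul_self_nonneg (v : ι → H) (s : Finset ι) (a : H →L[𝕜] H) :
    0 ≤ finTrace v s (star a * a) := by
  rw [finTrace_apply]
  refine Finset.sum_nonneg fun j _ => ?_
  rw [mul_apply_eq_comp, ContinuousLinearMap.star_eq_adjoint,
    ContinuousLinearMap.adjoint_inner_right]
  exact inner_self_nonneg

lemma finTrace_mul_comm {v : ι → H} (hv : Orthonormal 𝕜 v) {s : Finset ι}
    {a : H →L[𝕜] H} (ha : Commute a (finProj 𝕜 v s)) (b : H →L[𝕜] H) :
    finTrace v s (a * b) = finTrace v s (b * a) := by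
  rw [finTrace_apply, finTrace_apply,
    Finset.sum_congr rfl fun j hj => congrArg RCLike.re (inner_mul_apply_eq_sum_left hv ha b hj),
    Finset.sum_congr rfl fun j hj => congrArg RCLike.re (inner_mul_apply_eq_sum_right hv ha b hj)]
  simp only [map_sum]
  rw [Finset.sum_comm]
  refine Finset.sum_congr rfl fun l _ => Finset.sum_congr rfl fun j _ => ?_
  rw [mul_comm]

open scoped ComplexOrder MatrixOrder in
/-- Both matrices `⟪v j, a (v l)⟫` and `⟪v j, b (v l)⟫` are positive semidefinite, so the trace of
their product is nonnegative. -/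
lemma finTrace_mul_nonneg {v : ι → H} (hv : Orthonormal 𝕜 v) {s : Finset ι}
    {a b : H →L[𝕜] H} (hcomm : Commute a (finProj 𝕜 v s)) (ha : a.IsPositive)
    (hb : b.IsPositive) : 0 ≤ finTrace v s (a * b) := by
  classical
  let m : (H →L[𝕜] H) → Matrix s s 𝕜 := fun c => Matrix.of fun j l => inner 𝕜 (v j) (c (v l))
  have hm : ∀ c : H →L[𝕜] H, c.IsPositive → (m c).PosSemidef := fun c hc => by
    refine Matrix.PosSemidef.of_dotProduct_mulVec_nonneg ?_ fun x => ?_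
    · ext j l
      simp only [m, Matrix.conjTranspose_apply, Matrix.of_apply]
      rw [RCLike.star_def, inner_conj_symm, hc.isSelfAdjoint.inner_apply_left]
    · have : star x ⬝ᵥ (m c).mulVec x
          = inner 𝕜 (∑ j, x j • v j) (c (∑ l, x l • v l)) := by
        simp only [dotProduct, Matrix.mulVec, m, Matrix.of_apply, sum_inner, map_sum, inner_sum,
          map_smul, inner_smul_left, inner_smul_right, Pi.star_apply, RCLike.star_def,
          Finset.mul_sum]
        rw [Finset.sum_comm]
        exact Finset.sum_congr rfl fun j _ => Finset.sum_congr rfl fun l _ => by ring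
      rw [this]
      exact hc.inner_nonneg_right _
  have htr : finTrace v s (a * b) = RCLike.re (Matrix.trace (m a * m b)) := by
    rw [finTrace_apply, Matrix.trace, map_sum, ← Finset.sum_coe_sort s]
    refine Finset.sum_congr rfl fun j _ => ?_
    rw [inner_mul_apply_eq_sum_left hv hcomm b j.2, ← Finset.sum_coe_sort s]
    simp [m, Matrix.mul_apply]
  obtain ⟨B, hB⟩ : ∃ B : Matrix s s 𝕜, m a = star B * B := by
    exact CStarAlgebra.nonneg_iff_eq_star_mul_self.mp (hm a ha).nonneg
  rw [htr, hB, mul_assoc, Matrix.trace_mul_comm]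
  have := ((hm b hb).mul_mul_conjTranspose_same B).trace_nonneg
  exact (RCLike.nonneg_iff.1 this).1

/-- The Golden-Thompson inequality for self-adjoint operators that are block diagonal with respect
to a finite-dimensional subspace, and the trace over this subspace. -/
lemma finTrace_exp_add_le {v : ι → H} (hv : Orthonormal 𝕜 v) {s : Finset ι}
    {a b : H →L[𝕜] H} (ha : IsSelfAdjoint a) (hb : IsSelfAdjoint b)
    (hca : Commute a (finProj 𝕜 v s)) (hcb : Commute b (finProj 𝕜 v s)) :
    finTrace v s (NormedSpace.exp (a + b))
      ≤ finTrace v s (NormedSpace.exp a * NormedSpace.exp b) := by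
  set R : StarSubalgebra 𝕜 (H →L[𝕜] H) := StarSubalgebra.centralizer 𝕜 {finProj 𝕜 v s} with hR
  have hmem : ∀ c : H →L[𝕜] H, c ∈ R ↔ Commute c (finProj 𝕜 v s) := fun c => by
    rw [hR, StarSubalgebra.mem_centralizer_iff]
    simp only [Set.mem_singleton_iff, forall_eq, (finProj_isSelfAdjoint v s).star_eq, and_self]
    exact ⟨fun h => h.symm, fun h => h.symm⟩
  let τ : R →+ ℝ := (finTrace v s : (H →L[𝕜] H) →L[ℝ] ℝ).toLinearMap.toAddMonoidHom.comp
    R.subtype.toRingHom.toAddMonoidHom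
  have hτ : ∀ c : R, τ c = finTrace v s (c : H →L[𝕜] H) := fun _ => rfl
  have key : ∀ j : ℕ, finTrace v s ((NormedSpace.exp (((2 : ℝ) ^ j)⁻¹ • a)
      * NormedSpace.exp (((2 : ℝ) ^ j)⁻¹ • b)) ^ 2 ^ j)
      ≤ finTrace v s (NormedSpace.exp a * NormedSpace.exp b) := fun j => by
    have hX := (hca.smul_left ((2 : ℝ) ^ j)⁻¹).exp_left
    have hY := (hcb.smul_left ((2 : ℝ) ^ j)⁻¹).exp_left
    have h := (tracial_pow_two_pow_le (τ := τ)
      (fun c d => finTrace_mul_comm hv ((hmem _).1 c.2) d)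
      (fun c => finTrace_star v s _) (fun c => finTrace_star_mul_self_nonneg v s _) j).2
      ⟨_, (hmem _).2 hX⟩ ⟨_, (hmem _).2 hY⟩ (Subtype.ext (ha.real_smul _).exp)
      (Subtype.ext (hb.real_smul _).exp)
    rw [hτ, hτ] at h
    refine h.trans_eq ?_
    let : NormedAlgebra ℚ (H →L[𝕜] H) := .restrictScalars ℚ ℝ _
    have hpow : ∀ c : H →L[𝕜] H,
        NormedSpace.exp (((2 : ℝ) ^ j)⁻¹ • c) ^ 2 ^ j = NormedSpace.exp c := fun c => by
      rw [← NormedSpace.exp_nsmul, ← Nat.cast_smul_eq_nsmul ℝ, smul_smul]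
      simp
    simp [hpow]
  refine le_of_tendsto' (((finTrace v s : (H →L[𝕜] H) →L[ℝ] ℝ).continuous.tendsto _).comp
    (tendsto_lie_product ContinuousLinearMap.norm_id_le a b)) key

lemma finTrace_exp_add_le_half_add {v : ι → H} (hv : Orthonormal 𝕜 v) {s : Finset ι}
    {a b : H →L[𝕜] H} (ha : IsSelfAdjoint a) (hb : IsSelfAdjoint b)
    (hca : Commute a (finProj 𝕜 v s)) (hcb : Commute b (finProj 𝕜 v s)) :
    finTrace v s (NormedSpace.exp (a + b))
      ≤ (finTrace v s (NormedSpace.exp ((2 : ℝ) • a))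
        + finTrace v s (NormedSpace.exp ((2 : ℝ) • b))) / 2 := by
  refine (finTrace_exp_add_le hv ha hb hca hcb).trans ?_
  have h := finTrace_star_mul_self_nonneg v s (NormedSpace.exp a - NormedSpace.exp b)
  have e : star (NormedSpace.exp a - NormedSpace.exp b) * (NormedSpace.exp a - NormedSpace.exp b)
      = NormedSpace.exp ((2 : ℝ) • a) + NormedSpace.exp ((2 : ℝ) • b)
        - NormedSpace.exp a * NormedSpace.exp b - NormedSpace.exp b * NormedSpace.exp a := by
    rw [star_sub, ha.exp.star_eq, hb.exp.star_eq, exp_smul_eq_half_mul_half a,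
      exp_smul_eq_half_mul_half b, div_self two_ne_zero, one_smul, one_smul]
    noncomm_ring
  rw [e, map_sub, map_sub, map_add, ← finTrace_mul_comm hv hca.exp_left] at h
  linarith

end FiniteTrace

/-! ### Expectations of random operators -/

section OperatorIntegral

lemma integrable_re_inner {Ω 𝕜 H : Type*} [MeasurableSpace Ω] {μ : Measure Ω} [RCLike 𝕜]
    [NormedAddCommGroup H] [InnerProductSpace 𝕜 H] [NormedSpace ℝ H] [IsScalarTower ℝ 𝕜 H] {f : Ω → H →L[𝕜] H} (hf : Integrable f μ) (x y : H) :
    Integrable (fun ω => RCLike.re (inner 𝕜 x (f ω y))) μ :=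
  (reInnerCLM (𝕜 := 𝕜) x y).integrable_comp hf

lemma ae_re_inner_sum_le {Ω 𝕜 H κ : Type*} [MeasurableSpace Ω] {μ : Measure Ω} [RCLike 𝕜]
    [NormedAddCommGroup H] [InnerProductSpace 𝕜 H] (K : Finset κ) {A : κ → Ω → H →L[𝕜] H} {c : ℝ}
    (hA : ∀ i ∈ K, ∀ᵐ ω ∂μ, ∀ x, RCLike.re (inner 𝕜 x (A i ω x)) ≤ c * ‖x‖ ^ 2) :
    ∀ᵐ ω ∂μ, ∀ x, RCLike.re (inner 𝕜 x ((∑ i ∈ K, A i ω) x)) ≤ K.card * c * ‖x‖ ^ 2 := by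
  filter_upwards [(Filter.eventually_all_finset K).2 hA] with ω hω x
  rw [sum_apply, inner_sum, map_sum]
  refine (Finset.sum_le_sum fun j hj => hω j hj x).trans_eq ?_
  rw [Finset.sum_const, nsmul_eq_mul, mul_assoc]

lemma integrable_exp_sub_one_sub {Ω 𝕜 H : Type*} [MeasurableSpace Ω] {μ : Measure Ω}
    [IsProbabilityMeasure μ] [RCLike 𝕜] [NormedAddCommGroup H] [InnerProductSpace 𝕜 H] {f : Ω → H →L[𝕜] H} (hf : Integrable f μ)
    (he : Integrable (fun ω => NormedSpace.exp (f ω)) μ) :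
    Integrable (fun ω => NormedSpace.exp (f ω) - 1 - f ω) μ :=
  (he.sub (integrable_const _)).sub hf

variable {Ω 𝕜 H : Type*} [MeasurableSpace Ω] {μ : Measure Ω} [RCLike 𝕜] [NormedAddCommGroup H]
  [InnerProductSpace 𝕜 H] [NormedSpace ℝ H] [IsScalarTower ℝ 𝕜 H] [CompleteSpace H]

lemma re_inner_integral {f : Ω → H →L[𝕜] H} (hf : Integrable f μ) (x y : H) :
    RCLike.re (inner 𝕜 x ((∫ ω, f ω ∂μ) y)) = ∫ ω, RCLike.re (inner 𝕜 x (f ω y)) ∂μ :=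
  ((reInnerCLM (𝕜 := 𝕜) x y).integral_comp_comm hf).symm

lemma isSelfAdjoint_integral {f : Ω → H →L[𝕜] H} (hf : Integrable f μ)
    (hs : ∀ ω, IsSelfAdjoint (f ω)) : IsSelfAdjoint (∫ ω, f ω ∂μ) := by
  have key : ∀ x y : H, inner 𝕜 x ((∫ ω, f ω ∂μ) y) = ∫ ω, inner 𝕜 x (f ω y) ∂μ := fun x y =>
    (((innerSL 𝕜 x) ∘L (ContinuousLinearMap.apply 𝕜 H y)).integral_comp_comm hf).symm
  refine ContinuousLinearMap.isSelfAdjoint_iff_isSymmetric.2 fun x y => ?_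
  simp only [ContinuousLinearMap.coe_coe]
  rw [key, ← inner_conj_symm, key, ← integral_conj]
  refine integral_congr_ae (Filter.Eventually.of_forall fun ω => ?_)
  simp only [inner_conj_symm, (hs ω).inner_apply_left]

lemma isPositive_of_re_inner_nonneg {𝕜 H : Type*} [RCLike 𝕜] [NormedAddCommGroup H]
    [InnerProductSpace 𝕜 H] [CompleteSpace H] {a : H →L[𝕜] H} (ha : IsSelfAdjoint a)
    (h : ∀ x, 0 ≤ RCLike.re (inner 𝕜 x (a x))) : a.IsPositive := by
  refine ContinuousLinearMap.isPositive_def'.2 ⟨ha, fun x => ?_⟩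
  rw [ContinuousLinearMap.reApplyInnerSelf_apply, inner_re_symm]
  exact h x

lemma stronglyMeasurable_operator_exp {Ω : Type*} {m : MeasurableSpace Ω} {f : Ω → H →L[𝕜] H}
    (hf : StronglyMeasurable[m] f) :
    StronglyMeasurable[m] fun ω => NormedSpace.exp (f ω) := by
  let : NormedAlgebra ℚ (H →L[𝕜] H) := .restrictScalars ℚ ℝ _
  exact NormedSpace.exp_continuous.comp_stronglyMeasurable hf

variable [IsProbabilityMeasure μ]

lemma integrable_exp_of_re_inner_le {f : Ω → H →L[𝕜] H} (hf : StronglyMeasurable f)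
    (hs : ∀ ω, IsSelfAdjoint (f ω)) {c : ℝ}
    (hc : ∀ᵐ ω ∂μ, ∀ x, RCLike.re (inner 𝕜 x (f ω x)) ≤ c * ‖x‖ ^ 2) :
    Integrable (fun ω => NormedSpace.exp (f ω)) μ := by
  refine Integrable.of_bound (stronglyMeasurable_operator_exp hf).aestronglyMeasurable (Real.exp c) ?_
  filter_upwards [hc] with ω hω
  exact norm_exp_le_of_re_inner_le (hs ω) hω

lemma integral_exp_sub_one {f : Ω → H →L[𝕜] H} (hf : Integrable f μ) (h0 : ∫ ω, f ω ∂μ = 0)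
    (he : Integrable (fun ω => NormedSpace.exp (f ω)) μ) :
    (∫ ω, NormedSpace.exp (f ω) ∂μ) - 1 = ∫ ω, (NormedSpace.exp (f ω) - 1 - f ω) ∂μ := by
  have he1 : Integrable (fun ω => NormedSpace.exp (f ω) - 1) μ := he.sub (integrable_const _)
  rw [integral_sub he1 hf, h0, sub_zero, integral_sub he (integrable_const _)]
  simp

/-- Jensen's inequality for the exponential of a centred self-adjoint random operator. -/
lemma isPositive_integral_exp_sub_one {f : Ω → H →L[𝕜] H} (hf : Integrable f μ)
    (h0 : ∫ ω, f ω ∂μ = 0) (hs : ∀ ω, IsSelfAdjoint (f ω))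
    (he : Integrable (fun ω => NormedSpace.exp (f ω)) μ) :
    ((∫ ω, NormedSpace.exp (f ω) ∂μ) - 1).IsPositive := by
  refine isPositive_of_re_inner_nonneg
    ((isSelfAdjoint_integral he fun ω => (hs ω).exp).sub (.one _)) fun x => ?_
  rw [integral_exp_sub_one hf h0 he,
    re_inner_integral (integrable_exp_sub_one_sub hf he)]
  exact integral_nonneg fun ω => (re_inner_exp_sub_one_sub (hs ω) x).1

end OperatorIntegral

section Blocks

variable {Ω ι 𝕜 H : Type*} [MeasurableSpace Ω] [RCLike 𝕜] [NormedAddCommGroup H]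
  [InnerProductSpace 𝕜 H] [NormedSpace ℝ H] [IsScalarTower ℝ 𝕜 H] [CompleteSpace H]

/-- A centred self-adjoint random operator, block diagonal with respect to the span of `v j`,
`j ∈ s`, bounded above by `c`, whose second moment is at most `lam` as an operator and at most
`rho` in trace over this span. -/
structure IsCenteredBlock (v : ι → H) (s : Finset ι) (μ : Measure Ω) (c lam rho : ℝ)
    (A : Ω → H →L[𝕜] H) : Prop where
  stronglyMeasurable : StronglyMeasurable A
  isSelfAdjoint : ∀ ω, IsSelfAdjoint (A ω)
  commute : ∀ ω, Commute (A ω) (finProj 𝕜 v s)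
  bound : ∀ᵐ ω ∂μ, ∀ x, RCLike.re (inner 𝕜 x (A ω x)) ≤ c * ‖x‖ ^ 2
  integrable : Integrable A μ
  integral_eq_zero : ∫ ω, A ω ∂μ = 0
  integrable_sq : Integrable (fun ω => A ω * A ω) μ
  variance_le : ∀ x, ∫ ω, ‖A ω x‖ ^ 2 ∂μ ≤ lam * ‖x‖ ^ 2
  trace_le : ∫ ω, finTrace v s (A ω * A ω) ∂μ ≤ rho

variable {v : ι → H} {s : Finset ι} {μ : Measure Ω} [IsProbabilityMeasure μ] {c lam rho : ℝ}

lemma IsCenteredBlock.re_inner_integral_exp_le {A : Ω → H →L[𝕜] H}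
    (hA : IsCenteredBlock v s μ c lam rho A) (hc0 : 0 ≤ c) (x : H) :
    RCLike.re (inner 𝕜 x (((∫ ω, NormedSpace.exp (A ω) ∂μ) - 1) x))
      ≤ Real.exp c / 2 * lam * ‖x‖ ^ 2 := by
  have he := integrable_exp_of_re_inner_le hA.stronglyMeasurable hA.isSelfAdjoint hA.bound
  have hi := integrable_exp_sub_one_sub hA.integrable he
  have hsq : Integrable (fun ω => ‖A ω x‖ ^ 2) μ := by
    refine (integrable_re_inner hA.integrable_sq x x).congr (Filter.Eventually.of_forall fun ω => ?_)
    exact re_inner_mul_self (hA.isSelfAdjoint ω) x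
  rw [integral_exp_sub_one hA.integrable hA.integral_eq_zero he, re_inner_integral hi]
  calc _ ≤ ∫ ω, Real.exp c / 2 * ‖A ω x‖ ^ 2 ∂μ := by
        refine integral_mono_ae (integrable_re_inner hi x x) (hsq.const_mul _) ?_
        filter_upwards [hA.bound] with ω hω
        exact (re_inner_exp_sub_one_sub (hA.isSelfAdjoint ω) x).2 c hc0 hω
    _ = Real.exp c / 2 * ∫ ω, ‖A ω x‖ ^ 2 ∂μ := integral_const_mul _ _
    _ ≤ Real.exp c / 2 * (lam * ‖x‖ ^ 2) := by gcongr; exact hA.variance_le x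
    _ = _ := by ring

lemma IsCenteredBlock.finTrace_integral_exp_le {A : Ω → H →L[𝕜] H}
    (hA : IsCenteredBlock v s μ c lam rho A) (hc0 : 0 ≤ c) :
    finTrace v s ((∫ ω, NormedSpace.exp (A ω) ∂μ) - 1) ≤ Real.exp c / 2 * rho := by
  have he := integrable_exp_of_re_inner_le hA.stronglyMeasurable hA.isSelfAdjoint hA.bound
  have hi := integrable_exp_sub_one_sub hA.integrable he
  rw [integral_exp_sub_one hA.integrable hA.integral_eq_zero he,
    ← (finTrace v s).integral_comp_comm hi]
  calc _ ≤ ∫ ω, Real.exp c / 2 * finTrace v s (A ω * A ω) ∂μ := by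
        refine integral_mono_ae ((finTrace v s).integrable_comp hi)
          (((finTrace v s).integrable_comp hA.integrable_sq).const_mul _) ?_
        filter_upwards [hA.bound] with ω hω
        simp only [finTrace_mul_self v s (hA.isSelfAdjoint ω)]
        rw [finTrace_apply, Finset.mul_sum]
        exact Finset.sum_le_sum fun j _ =>
          (re_inner_exp_sub_one_sub (hA.isSelfAdjoint ω) _).2 c hc0 hω
    _ = Real.exp c / 2 * ∫ ω, finTrace v s (A ω * A ω) ∂μ := integral_const_mul _ _
    _ ≤ _ := by gcongr; exact hA.trace_le

/-- Adding an independent centred block: by the Golden-Thompson inequality and independence, the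
trace moment is at most the trace of a product of two expectations, in which the one belonging to
the new block is at most `1 + exp c / 2 * lam` as an operator. -/
lemma IsCenteredBlock.integral_finTrace_exp_add_le (hv : Orthonormal 𝕜 v) {A S : Ω → H →L[𝕜] H}
    (hA : IsCenteredBlock v s μ c lam rho A) (hc0 : 0 ≤ c)
    (hSm : StronglyMeasurable S) (hSs : ∀ ω, IsSelfAdjoint (S ω))
    (hSc : ∀ ω, Commute (S ω) (finProj 𝕜 v s)) {d : ℝ}
    (hSb : ∀ᵐ ω ∂μ, ∀ x, RCLike.re (inner 𝕜 x (S ω x)) ≤ d * ‖x‖ ^ 2)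
    (hSi : Integrable S μ) (hS0 : ∫ ω, S ω ∂μ = 0) (hind : IndepFun S A μ) :
    ∫ ω, finTrace v s (NormedSpace.exp (S ω + A ω)) ∂μ - finTrace v s (1 : H →L[𝕜] H)
      ≤ (1 + Real.exp c / 2 * lam) *
          (∫ ω, finTrace v s (NormedSpace.exp (S ω)) ∂μ - finTrace v s (1 : H →L[𝕜] H))
        + Real.exp c / 2 * rho := by
  let : NormedAlgebra ℚ (H →L[𝕜] H) := .restrictScalars ℚ ℝ _
  have heS := integrable_exp_of_re_inner_le hSm hSs hSb
  have heA := integrable_exp_of_re_inner_le hA.stronglyMeasurable hA.isSelfAdjoint hA.bound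
  have heSA : Integrable (fun ω => NormedSpace.exp (S ω + A ω)) μ := by
    refine integrable_exp_of_re_inner_le (c := d + c) (hSm.add hA.stronglyMeasurable)
      (fun ω => (hSs ω).add (hA.isSelfAdjoint ω)) ?_
    filter_upwards [hSb, hA.bound] with ω h1 h2 x
    rw [add_apply, inner_add_right, map_add, add_mul]
    exact add_le_add (h1 x) (h2 x)
  have hexp : Measurable (NormedSpace.exp : (H →L[𝕜] H) → H →L[𝕜] H) :=
    NormedSpace.exp_continuous.measurable
  have hind' : IndepFun (fun ω => NormedSpace.exp (S ω)) (fun ω => NormedSpace.exp (A ω)) μ :=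
    hind.comp hexp hexp
  have hprod : Integrable (fun ω => NormedSpace.exp (S ω) * NormedSpace.exp (A ω)) μ := by
    refine Integrable.of_bound
      (heS.aestronglyMeasurable.mul heA.aestronglyMeasurable) (Real.exp d * Real.exp c) ?_
    filter_upwards [hSb, hA.bound] with ω h1 h2
    refine (norm_mul_le _ _).trans ?_
    gcongr
    · exact norm_exp_le_of_re_inner_le (hSs ω) h1
    · exact norm_exp_le_of_re_inner_le (hA.isSelfAdjoint ω) h2
  set U := ∫ ω, NormedSpace.exp (S ω) ∂μ with hU
  set W := ∫ ω, NormedSpace.exp (A ω) ∂μ with hW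
  have hUW : ∫ ω, finTrace v s (NormedSpace.exp (S ω) * NormedSpace.exp (A ω)) ∂μ
      = finTrace v s (U * W) := by
    rw [(finTrace v s).integral_comp_comm hprod]
    congr 1
    exact hind'.integral_bilin heS heA (ContinuousLinearMap.mul ℝ (H →L[𝕜] H))
  have hGT : ∫ ω, finTrace v s (NormedSpace.exp (S ω + A ω)) ∂μ ≤ finTrace v s (U * W) := by
    rw [← hUW]
    exact integral_mono ((finTrace v s).integrable_comp heSA) ((finTrace v s).integrable_comp hprod)
      fun ω => finTrace_exp_add_le hv (hSs ω) (hA.isSelfAdjoint ω) (hSc ω) (hA.commute ω)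
  have hUint : ∫ ω, finTrace v s (NormedSpace.exp (S ω)) ∂μ = finTrace v s U :=
    (finTrace v s).integral_comp_comm heS
  have hUpos : (U - 1).IsPositive := isPositive_integral_exp_sub_one hSi hS0 hSs heS
  have hUcomm : Commute (U - 1) (finProj 𝕜 v s) := by
    refine Commute.sub_left ?_ (Commute.one_left _)
    have h1 := ((ContinuousLinearMap.mul ℝ (H →L[𝕜] H)).flip (finProj 𝕜 v s)).integral_comp_comm heS
    have h2 := (ContinuousLinearMap.mul ℝ (H →L[𝕜] H) (finProj 𝕜 v s)).integral_comp_comm heS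
    simp only [ContinuousLinearMap.flip_apply, ContinuousLinearMap.mul_apply'] at h1 h2
    rw [Commute, SemiconjBy, hU, ← h1, ← h2]
    exact integral_congr_ae (Filter.Eventually.of_forall fun ω => (hSc ω).exp_left.eq)
  have hWsa : IsSelfAdjoint W := isSelfAdjoint_integral heA fun ω => (hA.isSelfAdjoint ω).exp
  have hWpos : (((Real.exp c / 2 * lam : ℝ) • (1 : H →L[𝕜] H)) - (W - 1)).IsPositive := by
    refine isPositive_of_re_inner_nonneg
      ((IsSelfAdjoint.real_smul (.one _) _).sub (hWsa.sub (.one _))) fun x => ?_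
    have h := hA.re_inner_integral_exp_le hc0 x
    rw [← hW] at h
    have e : RCLike.re (inner 𝕜 x (((Real.exp c / 2 * lam : ℝ) • (1 : H →L[𝕜] H)) x))
        = Real.exp c / 2 * lam * ‖x‖ ^ 2 := by
      have := (reInnerCLM (𝕜 := 𝕜) x x).map_smul (Real.exp c / 2 * lam) 1
      simpa only [reInnerCLM_apply, one_apply_eq_self, inner_self_eq_norm_sq, smul_eq_mul] using this
    rw [sub_apply, inner_sub_right, map_sub, e]
    linarith
  have hmul := finTrace_mul_nonneg hv hUcomm hUpos hWpos
  have htr := hA.finTrace_integral_exp_le hc0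
  rw [← hW] at htr
  have e1 : (U - 1) * (((Real.exp c / 2 * lam : ℝ) • (1 : H →L[𝕜] H)) - (W - 1))
      = (Real.exp c / 2 * lam : ℝ) • (U - 1) - U * W + U + W - 1 := by
    rw [mul_sub, mul_smul_comm, mul_one]; noncomm_ring
  rw [e1, map_sub, map_add, map_add, map_sub, map_smul, smul_eq_mul, map_sub] at hmul
  rw [map_sub] at htr
  rw [hUint]
  linarith

lemma geom_step_le {p y a : ℝ} {r : ℕ} (hp : 0 ≤ p) (hy : 0 ≤ y)
    (h : a ≤ r * y * (1 + p) ^ r) :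
    (1 + p) * a + y ≤ (r + 1 : ℕ) * y * (1 + p) ^ (r + 1) := by
  have h1 : y ≤ y * (1 + p) ^ (r + 1) :=
    le_mul_of_one_le_right hy (one_le_pow₀ (le_add_of_nonneg_right hp))
  have h2 : (1 + p) * a ≤ (1 + p) * (r * y * (1 + p) ^ r) := by gcongr
  calc _ ≤ (1 + p) * (r * y * (1 + p) ^ r) + y * (1 + p) ^ (r + 1) := add_le_add h2 h1
    _ = _ := by push_cast; ring

/-- The trace moment of a sum of `m` centred blocks, each independent of the sum of the preceding
ones. -/
lemma integral_finTrace_exp_sum_le (hv : Orthonormal 𝕜 v) {m : ℕ} {A : ℕ → Ω → H →L[𝕜] H}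
    (hA : ∀ i < m, IsCenteredBlock v s μ c lam rho (A i)) (hc0 : 0 ≤ c) (hlam : 0 ≤ lam)
    (hrho : 0 ≤ rho)
    (hind : ∀ i < m, IndepFun (fun ω => ∑ j ∈ Finset.range i, A j ω) (A i) μ) :
    ∫ ω, finTrace v s (NormedSpace.exp (∑ j ∈ Finset.range m, A j ω)) ∂μ
        - finTrace v s (1 : H →L[𝕜] H)
      ≤ m * (Real.exp c / 2 * rho) * (1 + Real.exp c / 2 * lam) ^ m := by
  suffices h : ∀ r ≤ m, ∫ ω, finTrace v s (NormedSpace.exp (∑ j ∈ Finset.range r, A j ω)) ∂μ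
        - finTrace v s (1 : H →L[𝕜] H)
      ≤ r * (Real.exp c / 2 * rho) * (1 + Real.exp c / 2 * lam) ^ r from h m le_rfl
  intro r
  induction r with
  | zero => intro _; simp
  | succ r ih =>
    intro hr
    have hlt : ∀ j ∈ Finset.range r, j < m := fun j hj => (Finset.mem_range.1 hj).trans (by omega)
    have hb : ∀ᵐ ω ∂μ, ∀ x,
        RCLike.re (inner 𝕜 x ((∑ j ∈ Finset.range r, A j ω) x)) ≤ r * c * ‖x‖ ^ 2 := by
      simpa using ae_re_inner_sum_le (Finset.range r) fun j hj => (hA j (hlt j hj)).bound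
    have h0 : ∫ ω, ∑ j ∈ Finset.range r, A j ω ∂μ = 0 := by
      rw [integral_finsetSum _ fun j hj => (hA j (hlt j hj)).integrable]
      exact Finset.sum_eq_zero fun j hj => (hA j (hlt j hj)).integral_eq_zero
    have hm : StronglyMeasurable fun ω => ∑ j ∈ Finset.range r, A j ω :=
      Finset.stronglyMeasurable_fun_sum _ fun j hj => (hA j (hlt j hj)).stronglyMeasurable
    have hs : ∀ ω, IsSelfAdjoint (∑ j ∈ Finset.range r, A j ω) := fun ω =>
      isSelfAdjoint_sum _ fun j hj => (hA j (hlt j hj)).isSelfAdjoint ω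
    have hc : ∀ ω, Commute (∑ j ∈ Finset.range r, A j ω) (finProj 𝕜 v s) := fun ω => by
      have hcj : ∀ j ∈ Finset.range r, Commute (A j ω) (finProj 𝕜 v s) := fun j hj =>
        (hA j (hlt j hj)).commute ω
      exact Commute.sum_left _ _ _ hcj
    have hi : Integrable (fun ω => ∑ j ∈ Finset.range r, A j ω) μ :=
      integrable_finsetSum (Finset.range r) (f := A) fun j hj => (hA j (hlt j hj)).integrable
    have hstep := (hA r hr).integral_finTrace_exp_add_le hv hc0 hm hs hc hb hi h0 (hind r hr)
    simp only [Finset.sum_range_succ]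
    exact hstep.trans (geom_step_le (by positivity) (by positivity) (ih (by omega)))

end Blocks

/-! ### Hilbert-Schmidt operators and Hilbert bases -/

section HilbertSchmidt

variable {ι 𝕜 H : Type*} [RCLike 𝕜] [NormedAddCommGroup H] [InnerProductSpace 𝕜 H]

lemma HilbertBasis.countable_of_separableSpace [TopologicalSpace.SeparableSpace H]
    (b : HilbertBasis ι 𝕜 H) : Countable ι := by
  refine Pairwise.countable_of_isOpen_disjoint (s := fun i => Metric.ball (b i) (1 / 2))
    (fun i j hij => ?_) (fun i => Metric.isOpen_ball) fun i => ⟨b i, by simp⟩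
  refine Metric.ball_disjoint_ball ?_
  have h : ‖b i - b j‖ ^ 2 = 2 := by
    rw [@norm_sub_sq 𝕜, b.orthonormal.1 i, b.orthonormal.1 j, b.orthonormal.2 hij]
    norm_num
  rw [dist_eq_norm]
  nlinarith [norm_nonneg (b i - b j)]

lemma HilbertBasis.hasSum_norm_inner_sq (b : HilbertBasis ι 𝕜 H) (x : H) :
    HasSum (fun j => ‖inner 𝕜 (b j) x‖ ^ 2) (‖x‖ ^ 2) := by
  have h := (RCLike.hasSum_re 𝕜 (b.hasSum_inner_mul_inner x x))
  rw [inner_self_eq_norm_sq] at h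
  refine h.congr_fun fun j => ?_
  rw [← inner_conj_symm x (b j), RCLike.conj_mul]
  norm_cast

lemma sum_enorm_sq_le_hsNormSq {v : ι → H} (hv : Orthonormal 𝕜 v) (a : H →L[𝕜] H)
    (F : Finset ι) : ∑ j ∈ F, ‖a (v j)‖ₑ ^ 2 ≤ hsNormSq a := by
  rw [← Finset.sum_coe_sort F, ← F.equivFin.symm.sum_comp]
  exact le_iSup₂_of_le (f := fun (m : ℕ) (e : Fin m → H) =>
    ⨆ (_ : Orthonormal 𝕜 e), ∑ i, ‖a (e i)‖ₑ ^ 2) F.card (fun i => v (F.equivFin.symm i))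
    (le_iSup_of_le (hv.comp _ (Subtype.val_injective.comp F.equivFin.symm.injective)) le_rfl)

lemma tsum_enorm_sq_le_hsNormSq {v : ι → H} (hv : Orthonormal 𝕜 v) (a : H →L[𝕜] H) :
    ∑' j, ‖a (v j)‖ₑ ^ 2 ≤ hsNormSq a :=
  ENNReal.summable.tsum_le_of_sum_le fun F => sum_enorm_sq_le_hsNormSq hv a F

lemma sum_enorm_inner_le_traceNorm {v : ι → H} (hv : Orthonormal 𝕜 v) (a : H →L[𝕜] H)
    (F : Finset ι) : ∑ j ∈ F, ‖inner 𝕜 (v j) (a (v j))‖ₑ ≤ traceNorm a := by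
  have ho : Orthonormal 𝕜 fun i => v (F.equivFin.symm i) :=
    hv.comp _ (Subtype.val_injective.comp F.equivFin.symm.injective)
  rw [← Finset.sum_coe_sort F, ← F.equivFin.symm.sum_comp]
  unfold traceNorm
  exact le_iSup_of_le F.card (le_iSup_of_le _ (le_iSup_of_le _
    (le_iSup_of_le ho (le_iSup_of_le ho le_rfl))))

lemma summable_norm_sq_of_hsNormSq_lt_top {v : ι → H} (hv : Orthonormal 𝕜 v) {a : H →L[𝕜] H}
    (ha : hsNormSq a < ⊤) : Summable fun j => ‖a (v j)‖ ^ 2 := by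
  have h := ENNReal.summable_toReal ((tsum_enorm_sq_le_hsNormSq hv a).trans_lt ha).ne
  simpa using h

variable [CompleteSpace H]

lemma norm_sub_finProj_apply_sq (b : HilbertBasis ι 𝕜 H) (s : Finset ι) (x : H) :
    HasSum (fun j => (↑s : Set ι)ᶜ.indicator (fun j => ‖inner 𝕜 (b j) x‖ ^ 2) j)
      (‖x - finProj 𝕜 b s x‖ ^ 2) := by
  classical
  refine (b.hasSum_norm_inner_sq (x - finProj 𝕜 b s x)).congr_fun fun j => ?_
  rw [inner_sub_right, ← (finProj_isSelfAdjoint b s).inner_apply_left]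
  by_cases hj : j ∈ s
  · rw [finProj_apply_mem b.orthonormal hj]; simp [hj]
  · have : finProj 𝕜 b s (b j) = 0 := by
      rw [finProj_apply]
      refine Finset.sum_eq_zero fun i hi => ?_
      rw [b.orthonormal.2 (ne_of_mem_of_not_mem hi hj), zero_smul]
    rw [this]; simp [hj]

/-- The norm of `(1 - P) a` is bounded by the tail of the Hilbert-Schmidt norm of `a`. -/
lemma norm_sub_finProj_mul_sq_le (b : HilbertBasis ι 𝕜 H) {a : H →L[𝕜] H} (ha : IsSelfAdjoint a)
    (hs : Summable fun j => ‖a (b j)‖ ^ 2) (s : Finset ι) :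
    ‖a - finProj 𝕜 b s * a‖ ^ 2 ≤ ∑' j : {j // j ∉ s}, ‖a (b j)‖ ^ 2 := by
  set T := ∑' j : {j // j ∉ s}, ‖a (b j)‖ ^ 2 with hT
  have hT0 : 0 ≤ T := tsum_nonneg fun _ => by positivity
  have hind : HasSum ((↑s : Set ι)ᶜ.indicator fun j => ‖a (b j)‖ ^ 2) T := by
    have := (hs.subtype (↑s : Set ι)ᶜ).hasSum
    exact (hasSum_subtype_iff_indicator (s := (↑s : Set ι)ᶜ)).1 this
  have hle : ‖a - finProj 𝕜 b s * a‖ ≤ Real.sqrt T := by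
    refine ContinuousLinearMap.opNorm_le_bound _ (Real.sqrt_nonneg _) fun x => ?_
    refine abs_le_of_sq_le_sq' ?_ (by positivity) |>.2
    rw [mul_pow, Real.sq_sqrt hT0]
    refine hasSum_le (fun j => ?_) (norm_sub_finProj_apply_sq b s (a x)) (hind.mul_right (‖x‖ ^ 2))
    by_cases hj : j ∈ s
    · simp [hj]
    · simp only [Set.mem_compl_iff, Finset.mem_coe, hj, not_false_eq_true, Set.indicator_of_mem]
      rw [← ha.inner_apply_left, ← mul_pow]
      gcongr
      exact norm_inner_le_norm _ _
  calc _ ≤ Real.sqrt T ^ 2 := by gcongr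
    _ = T := Real.sq_sqrt hT0

lemma norm_sq_le_tsum (b : HilbertBasis ι 𝕜 H) {a : H →L[𝕜] H} (ha : IsSelfAdjoint a)
    (hs : Summable fun j => ‖a (b j)‖ ^ 2) : ‖a‖ ^ 2 ≤ ∑' j, ‖a (b j)‖ ^ 2 := by
  have h := norm_sub_finProj_mul_sq_le b ha hs ∅
  rw [show finProj 𝕜 b ∅ = 0 by simp [finProj], zero_mul, sub_zero] at h
  refine h.trans_eq ?_
  exact (Equiv.subtypeUnivEquiv (p := fun j => j ∉ (∅ : Finset ι)) (by simp)).tsum_eq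
    fun j : ι => ‖a (b j)‖ ^ 2

lemma enorm_sq_le_tsum (b : HilbertBasis ι 𝕜 H) {a : H →L[𝕜] H} (ha : IsSelfAdjoint a) :
    ‖a‖ₑ ^ 2 ≤ ∑' j, ‖a (b j)‖ₑ ^ 2 := by
  by_cases htop : ∑' j, ‖a (b j)‖ₑ ^ 2 = ⊤
  · rw [htop]; exact le_top
  have hs : Summable fun j => ‖a (b j)‖ ^ 2 := by simpa using ENNReal.summable_toReal htop
  have h := ENNReal.ofReal_le_ofReal (norm_sq_le_tsum b ha hs)
  rw [ENNReal.ofReal_tsum_of_nonneg (fun _ => by positivity) hs] at h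
  simpa [ENNReal.ofReal_pow] using h

/-- Self-adjoint Hilbert-Schmidt operators are approximated in norm by their finite
compressions. -/
lemma tendsto_compress (b : HilbertBasis ι 𝕜 H) {a : H →L[𝕜] H} (ha : IsSelfAdjoint a)
    (hs : Summable fun j => ‖a (b j)‖ ^ 2) :
    Filter.Tendsto (fun s => compress b s a) Filter.atTop (nhds a) := by
  have htail := tendsto_tsum_compl_atTop_zero fun j : ι => ‖a (b j)‖ ^ 2
  have hsq : Filter.Tendsto (fun s : Finset ι => 2 * Real.sqrt (∑' j : {j // j ∉ s}, ‖a (b j)‖ ^ 2))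
      Filter.atTop (nhds 0) := by
    simpa using (htail.sqrt).const_mul 2
  rw [tendsto_iff_norm_sub_tendsto_zero]
  refine squeeze_zero (fun _ => norm_nonneg _) (fun s => ?_) hsq
  set P := finProj 𝕜 b s with hP
  have hPsa : IsSelfAdjoint P := finProj_isSelfAdjoint b s
  have h1 : ‖a - P * a‖ ≤ Real.sqrt (∑' j : {j // j ∉ s}, ‖a (b j)‖ ^ 2) :=
    Real.le_sqrt_of_sq_le (norm_sub_finProj_mul_sq_le b ha hs s)
  have h2 : ‖a - a * P‖ = ‖a - P * a‖ := by
    rw [← norm_star, star_sub, star_mul, ha.star_eq, hPsa.star_eq]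
  have hPle : ‖P‖ ≤ 1 := ContinuousLinearMap.opNorm_le_bound _ zero_le_one fun x => by
    rw [one_mul]; exact norm_finProj_apply_le b.orthonormal s x
  have e : compress b s a - a = -((a - P * a) * P) - (a - a * P) := by
    unfold compress; rw [← hP]; noncomm_ring
  rw [e]
  calc _ ≤ ‖(a - P * a) * P‖ + ‖a - a * P‖ := by
        refine (norm_sub_le _ _).trans ?_; rw [norm_neg]
    _ ≤ ‖a - P * a‖ * 1 + ‖a - P * a‖ := by
        rw [h2]
        gcongr
        exact (norm_mul_le _ _).trans (by gcongr)
    _ ≤ _ := by linarith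

end HilbertSchmidt

section LambdaMax

variable {𝕜 H : Type*} [RCLike 𝕜] [NormedAddCommGroup H] [InnerProductSpace 𝕜 H]

lemma re_inner_le_lambdaMax (a : H →L[𝕜] H) (x : H) :
    RCLike.re (inner 𝕜 x (a x)) ≤ lambdaMax a * ‖x‖ ^ 2 := by
  by_cases hx : x = 0
  · simp [hx]
  have hbdd : BddAbove (Set.range fun x : {x : H // x ≠ 0} => a.rayleighQuotient x) := by
    refine ⟨‖a‖, ?_⟩
    rintro _ ⟨y, rfl⟩
    exact (le_abs_self _).trans (a.rayleighQuotient_le_norm y)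
  have h : a.rayleighQuotient x ≤ lambdaMax a := le_ciSup hbdd ⟨x, hx⟩
  rw [inner_re_symm]
  exact (div_le_iff₀ (by positivity)).1 h

lemma norm_le_of_re_inner_le {a : H →L[𝕜] H} (ha : a.IsPositive) {c : ℝ} (hc0 : 0 ≤ c)
    (h : ∀ x, RCLike.re (inner 𝕜 x (a x)) ≤ c * ‖x‖ ^ 2) : ‖a‖ ≤ c := by
  rw [a.norm_eq_iSup_rayleighQuotient ha.isSymmetric]
  refine ciSup_le fun x => ?_
  rw [abs_of_nonneg (div_nonneg (ha.2 x) (by positivity))]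
  refine div_le_of_le_mul₀ (by positivity) hc0 ?_
  rw [ContinuousLinearMap.reApplyInnerSelf_apply, inner_re_symm]
  exact h x

end LambdaMax

/-! ### Second moments of random Hilbert-Schmidt operators -/

section SecondMoments

variable {Ω ι 𝕜 H : Type*} [MeasurableSpace Ω] {μ : Measure Ω} [RCLike 𝕜] [NormedAddCommGroup H]
  [InnerProductSpace 𝕜 H]

lemma integrable_of_integrable_norm_sq [IsFiniteMeasure μ] {f : Ω → H →L[𝕜] H}
    (hm : StronglyMeasurable f) (hf : Integrable (fun ω => ‖f ω‖ ^ 2) μ) : Integrable f μ := by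
  refine Integrable.mono' ((integrable_const (1 : ℝ)).add hf) hm.aestronglyMeasurable
    (Filter.Eventually.of_forall fun ω => ?_)
  simp only [Pi.add_apply]
  nlinarith [sq_nonneg (‖f ω‖ - 1), norm_nonneg (f ω)]

lemma integrable_mul_self {f : Ω → H →L[𝕜] H} (hm : StronglyMeasurable f)
    (hf : Integrable (fun ω => ‖f ω‖ ^ 2) μ) : Integrable (fun ω => f ω * f ω) μ := by
  refine Integrable.mono' hf (hm.aestronglyMeasurable.mul hm.aestronglyMeasurable)
    (Filter.Eventually.of_forall fun ω => ?_)
  rw [pow_two]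
  exact norm_mul_le _ _

lemma integrable_norm_sq_sum {κ : Type*} {X : κ → Ω → H →L[𝕜] H} (K : Finset κ)
    (hm : ∀ i ∈ K, StronglyMeasurable (X i))
    (hX : ∀ i ∈ K, Integrable (fun ω => ‖X i ω‖ ^ 2) μ) :
    Integrable (fun ω => ‖∑ i ∈ K, X i ω‖ ^ 2) μ := by
  have hsum : Integrable (fun ω => K.card * ∑ i ∈ K, ‖X i ω‖ ^ 2) μ :=
    (integrable_finsetSum K (f := fun i ω => ‖X i ω‖ ^ 2) hX).const_mul _
  refine Integrable.mono' hsum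
    ((Finset.stronglyMeasurable_fun_sum K hm).norm.pow 2).aestronglyMeasurable
    (Filter.Eventually.of_forall fun ω => ?_)
  rw [Real.norm_of_nonneg (by positivity)]
  refine (pow_le_pow_left₀ (norm_nonneg _) (norm_sum_le K fun i => X i ω) 2).trans ?_
  exact sq_sum_le_card_mul_sum_sq

lemma opTrace_le_intdim_mul_norm (b : HilbertBasis ι 𝕜 H) (a : H →L[𝕜] H) :
    opTrace b a ≤ intdim b a * ‖a‖ := by
  by_cases ha : a = 0
  · simp [ha, opTrace]
  · rw [intdim, div_mul_cancel₀ _ (norm_ne_zero_iff.2 ha)]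

variable [CompleteSpace H]

lemma integrable_norm_sq_of_lintegral_hsNormSq (b : HilbertBasis ι 𝕜 H) {f : Ω → H →L[𝕜] H}
    (hm : StronglyMeasurable f) (hs : ∀ ω, IsSelfAdjoint (f ω))
    (hL2 : ∫⁻ ω, hsNormSq (f ω) ∂μ < ⊤) : Integrable (fun ω => ‖f ω‖ ^ 2) μ := by
  refine ⟨(hm.norm.pow 2).aestronglyMeasurable, ?_⟩
  rw [HasFiniteIntegral]
  refine (lintegral_mono fun ω => ?_).trans_lt hL2
  rw [enorm_pow, enorm_norm]
  exact (enorm_sq_le_tsum b (hs ω)).trans (tsum_enorm_sq_le_hsNormSq b.orthonormal _)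

variable [NormedSpace ℝ H] [IsScalarTower ℝ 𝕜 H]

lemma integral_norm_apply_sq {f : Ω → H →L[𝕜] H} (hs : ∀ ω, IsSelfAdjoint (f ω))
    (hf : Integrable (fun ω => f ω * f ω) μ) (x : H) :
    ∫ ω, ‖f ω x‖ ^ 2 ∂μ = RCLike.re (inner 𝕜 x ((∫ ω, f ω * f ω ∂μ) x)) := by
  rw [re_inner_integral hf]
  exact integral_congr_ae (Filter.Eventually.of_forall fun ω => (re_inner_mul_self (hs ω) x).symm)

lemma integrable_norm_apply_sq {f : Ω → H →L[𝕜] H} (hs : ∀ ω, IsSelfAdjoint (f ω))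
    (hf : Integrable (fun ω => f ω * f ω) μ) (x : H) : Integrable (fun ω => ‖f ω x‖ ^ 2) μ :=
  (integrable_re_inner hf x x).congr
    (Filter.Eventually.of_forall fun ω => re_inner_mul_self (hs ω) x)

lemma isPositive_integral_mul_self {f : Ω → H →L[𝕜] H} (hs : ∀ ω, IsSelfAdjoint (f ω))
    (hf : Integrable (fun ω => f ω * f ω) μ) : (∫ ω, f ω * f ω ∂μ).IsPositive := by
  refine isPositive_of_re_inner_nonneg (isSelfAdjoint_integral hf fun ω => ?_) fun x => ?_
  · rw [isSelfAdjoint_iff, star_mul, (hs ω).star_eq]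
  · rw [← integral_norm_apply_sq hs hf]
    exact integral_nonneg fun ω => by positivity

/-- The second moment `E [f²]` of a square integrable random Hilbert-Schmidt operator is of trace
class, and its trace `E ‖f‖_HS²` dominates its norm. -/
lemma summable_and_norm_le_opTrace [Countable ι] (b : HilbertBasis ι 𝕜 H) {f : Ω → H →L[𝕜] H}
    (hm : StronglyMeasurable f) (hs : ∀ ω, IsSelfAdjoint (f ω))
    (hL2 : ∫⁻ ω, hsNormSq (f ω) ∂μ < ⊤) :
    Summable (fun j => RCLike.re (inner 𝕜 (b j) ((∫ ω, f ω * f ω ∂μ) (b j)))) ∧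
      ‖∫ ω, f ω * f ω ∂μ‖ ≤ opTrace b (∫ ω, f ω * f ω ∂μ) := by
  have hn := integrable_norm_sq_of_lintegral_hsNormSq b hm hs hL2
  have hsq := integrable_mul_self hm hn
  have hmeas : ∀ j, AEMeasurable (fun ω => ‖f ω (b j)‖ₑ ^ 2) μ := fun j =>
    ((((ContinuousLinearMap.apply 𝕜 H (b j)).continuous.comp_stronglyMeasurable hm).enorm).pow_const
      2).aemeasurable
  have hle : ∑' j, ∫⁻ ω, ‖f ω (b j)‖ₑ ^ 2 ∂μ ≤ ∫⁻ ω, hsNormSq (f ω) ∂μ := by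
    rw [← lintegral_tsum hmeas]
    exact lintegral_mono fun ω => tsum_enorm_sq_le_hsNormSq b.orthonormal _
  have htop := (hle.trans_lt hL2).ne
  have hterm : ∀ j, RCLike.re (inner 𝕜 (b j) ((∫ ω, f ω * f ω ∂μ) (b j)))
      = (∫⁻ ω, ‖f ω (b j)‖ₑ ^ 2 ∂μ).toReal := fun j => by
    rw [← integral_norm_apply_sq hs hsq, integral_eq_lintegral_of_nonneg_ae
      (Filter.Eventually.of_forall fun ω => by positivity)
      (integrable_norm_apply_sq hs hsq _).aestronglyMeasurable]
    simp [ENNReal.ofReal_pow]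
  refine ⟨by simpa only [hterm] using ENNReal.summable_toReal htop, ?_⟩
  have htr : opTrace b (∫ ω, f ω * f ω ∂μ) = (∑' j, ∫⁻ ω, ‖f ω (b j)‖ₑ ^ 2 ∂μ).toReal := by
    rw [ENNReal.tsum_toReal_eq fun j => ENNReal.ne_top_of_tsum_ne_top htop j]
    exact tsum_congr hterm
  rw [htr]
  calc ‖∫ ω, f ω * f ω ∂μ‖ ≤ (∫⁻ ω, ENNReal.ofReal ‖f ω * f ω‖ ∂μ).toReal :=
        norm_integral_le_lintegral_norm _
    _ ≤ _ := by
        refine ENNReal.toReal_mono htop ?_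
        rw [← lintegral_tsum hmeas]
        refine lintegral_mono fun ω => ?_
        rw [ofReal_norm]
        refine le_trans ?_ (enorm_sq_le_tsum b (hs ω))
        rw [pow_two, ← ofReal_norm, ← ofReal_norm, ← ENNReal.ofReal_mul (norm_nonneg _)]
        exact ENNReal.ofReal_le_ofReal (norm_mul_le _ _)

end SecondMoments

/-! ### Families of centred random operators bounded above -/

section Families

variable {Ω ι 𝕜 H : Type*} [MeasurableSpace Ω] [RCLike 𝕜] [NormedAddCommGroup H]
  [InnerProductSpace 𝕜 H] [NormedSpace ℝ H] [IsScalarTower ℝ 𝕜 H] [CompleteSpace H]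

/-- Centred, square integrable random self-adjoint Hilbert-Schmidt operators with spectrum
almost surely at most `M`. -/
structure IsCenteredFamily {N : ℕ} (μ : Measure Ω) (M : ℝ) (X : Fin N → Ω → H →L[𝕜] H) :
    Prop where
  stronglyMeasurable : ∀ i, StronglyMeasurable (X i)
  isSelfAdjoint : ∀ i ω, IsSelfAdjoint (X i ω)
  hsNormSq_lt_top : ∀ i ω, hsNormSq (X i ω) < ⊤
  lintegral_hsNormSq_lt_top : ∀ i, ∫⁻ ω, hsNormSq (X i ω) ∂μ < ⊤
  integral_eq_zero : ∀ i, ∫ ω, X i ω ∂μ = 0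
  bound : ∀ i, ∀ᵐ ω ∂μ, ∀ x, RCLike.re (inner 𝕜 x (X i ω x)) ≤ M * ‖x‖ ^ 2

variable {N : ℕ} {μ : Measure Ω} {M : ℝ} {X : Fin N → Ω → H →L[𝕜] H}

namespace IsCenteredFamily

lemma integrable_norm_sq (hX : IsCenteredFamily μ M X) (b : HilbertBasis ι 𝕜 H) (i : Fin N) :
    Integrable (fun ω => ‖X i ω‖ ^ 2) μ :=
  integrable_norm_sq_of_lintegral_hsNormSq b (hX.stronglyMeasurable i) (hX.isSelfAdjoint i)
    (hX.lintegral_hsNormSq_lt_top i)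

lemma stronglyMeasurable_sum (hX : IsCenteredFamily μ M X) (K : Finset (Fin N)) :
    StronglyMeasurable fun ω => ∑ i ∈ K, X i ω :=
  Finset.stronglyMeasurable_fun_sum K fun i _ => hX.stronglyMeasurable i

lemma isSelfAdjoint_sum (hX : IsCenteredFamily μ M X) (K : Finset (Fin N)) (ω : Ω) :
    IsSelfAdjoint (∑ i ∈ K, X i ω) :=
  _root_.isSelfAdjoint_sum K fun i _ => hX.isSelfAdjoint i ω

lemma integrable_sum_mul_self (hX : IsCenteredFamily μ M X) (b : HilbertBasis ι 𝕜 H)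
    (K : Finset (Fin N)) : Integrable (fun ω => (∑ i ∈ K, X i ω) * ∑ i ∈ K, X i ω) μ :=
  integrable_mul_self (hX.stronglyMeasurable_sum K) (integrable_norm_sq_sum K
    (fun i _ => hX.stronglyMeasurable i) fun i _ => hX.integrable_norm_sq b i)

lemma integrable_mul_self (hX : IsCenteredFamily μ M X) (b : HilbertBasis ι 𝕜 H) (i : Fin N) :
    Integrable (fun ω => X i ω * X i ω) μ :=
  _root_.integrable_mul_self (hX.stronglyMeasurable i) (hX.integrable_norm_sq b i)

lemma one_le_seqIntdim [Countable ι] (hX : IsCenteredFamily μ M X) (b : HilbertBasis ι 𝕜 H)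
    (hne : ∃ i, ∫ ω, X i ω * X i ω ∂μ ≠ 0) : 1 ≤ seqIntdim b X μ := by
  obtain ⟨i, hi⟩ := hne
  have h := (summable_and_norm_le_opTrace b (hX.stronglyMeasurable i) (hX.isSelfAdjoint i)
    (hX.lintegral_hsNormSq_lt_top i)).2
  have h1 : 1 ≤ intdim b (∫ ω, X i ω ^ 2 ∂μ) := by
    simp only [pow_two]
    exact (one_le_div (norm_pos_iff.2 hi)).2 h
  exact h1.trans (le_ciSup (f := fun i => intdim b (∫ ω, X i ω ^ 2 ∂μ))
    (Set.finite_range _).bddAbove i)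

lemma integrable_sum [IsProbabilityMeasure μ] (hX : IsCenteredFamily μ M X) (b : HilbertBasis ι 𝕜 H)
    (K : Finset (Fin N)) : Integrable (fun ω => ∑ i ∈ K, X i ω) μ :=
  integrable_finsetSum K (f := X) fun i _ =>
    integrable_of_integrable_norm_sq (hX.stronglyMeasurable i) (hX.integrable_norm_sq b i)

lemma integral_sum_eq_zero [IsProbabilityMeasure μ] (hX : IsCenteredFamily μ M X) (b : HilbertBasis ι 𝕜 H)
    (K : Finset (Fin N)) : ∫ ω, ∑ i ∈ K, X i ω ∂μ = 0 := by
  rw [integral_finsetSum K fun i _ =>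
    integrable_of_integrable_norm_sq (hX.stronglyMeasurable i) (hX.integrable_norm_sq b i)]
  exact Finset.sum_eq_zero fun i _ => hX.integral_eq_zero i

lemma integral_norm_sum_apply_sq_le (hX : IsCenteredFamily μ M X) (b : HilbertBasis ι 𝕜 H)
    (K : Finset (Fin N)) (x : H) :
    ∫ ω, ‖(∑ i ∈ K, X i ω) x‖ ^ 2 ∂μ ≤ K.card * blockVariance X μ * ‖x‖ ^ 2 := by
  rcases K.eq_empty_or_nonempty with rfl | hK
  · simp
  rw [integral_norm_apply_sq (hX.isSelfAdjoint_sum K) (hX.integrable_sum_mul_self b K)]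
  refine (re_inner_le_lambdaMax _ x).trans ?_
  have h : 1 / (K.card : ℝ) * lambdaMax (∫ ω, (∑ i ∈ K, X i ω) ^ 2 ∂μ) ≤ blockVariance X μ :=
    le_ciSup (f := fun K : {K : Finset (Fin N) // K.Nonempty} =>
      1 / (K.1.card : ℝ) * lambdaMax (∫ ω, (∑ i ∈ K.1, X i ω) ^ 2 ∂μ))
      (Set.finite_range _).bddAbove ⟨K, hK⟩
  simp only [pow_two (∑ i ∈ K, X i _)] at h
  have hc : (0 : ℝ) < K.card := by exact_mod_cast hK.card_pos
  rw [one_div, inv_mul_le_iff₀ hc] at h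
  gcongr

lemma integral_norm_apply_sq_le (hX : IsCenteredFamily μ M X) (b : HilbertBasis ι 𝕜 H)
    (i : Fin N) (x : H) : ∫ ω, ‖X i ω x‖ ^ 2 ∂μ ≤ blockVariance X μ * ‖x‖ ^ 2 := by
  simpa using hX.integral_norm_sum_apply_sq_le b {i} x

lemma blockVariance_nonneg (hX : IsCenteredFamily μ M X) (b : HilbertBasis ι 𝕜 H)
    (hne : ∃ i, ∫ ω, X i ω * X i ω ∂μ ≠ 0) : 0 ≤ blockVariance X μ := by
  obtain ⟨i, hi⟩ := hne
  obtain ⟨x, hx⟩ : ∃ x, (∫ ω, X i ω * X i ω ∂μ) x ≠ 0 := by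
    by_contra! h
    exact hi (ContinuousLinearMap.ext h)
  have hx0 : x ≠ 0 := by rintro rfl; simp at hx
  have h := (integral_nonneg fun ω => by positivity).trans (hX.integral_norm_apply_sq_le b i x)
  exact nonneg_of_mul_nonneg_left h (by positivity)

variable [Countable ι]

lemma sum_integral_norm_apply_sq_le (hX : IsCenteredFamily μ M X) (b : HilbertBasis ι 𝕜 H)
    (hne : ∃ i, ∫ ω, X i ω * X i ω ∂μ ≠ 0) (i : Fin N) (s : Finset ι) :
    ∑ j ∈ s, ∫ ω, ‖X i ω (b j)‖ ^ 2 ∂μ ≤ seqIntdim b X μ * blockVariance X μ := by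
  have hsq := hX.integrable_mul_self b i
  have hv0 := hX.blockVariance_nonneg b hne
  have hd0 := zero_le_one.trans (hX.one_le_seqIntdim b hne)
  have hpos := isPositive_integral_mul_self (hX.isSelfAdjoint i) hsq
  have hsum := (summable_and_norm_le_opTrace b (hX.stronglyMeasurable i) (hX.isSelfAdjoint i)
    (hX.lintegral_hsNormSq_lt_top i)).1
  simp only [integral_norm_apply_sq (hX.isSelfAdjoint i) hsq]
  have hnorm : ‖∫ ω, X i ω * X i ω ∂μ‖ ≤ blockVariance X μ :=
    norm_le_of_re_inner_le hpos hv0 fun x => by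
      rw [← integral_norm_apply_sq (hX.isSelfAdjoint i) hsq]
      exact hX.integral_norm_apply_sq_le b i x
  have hdim : intdim b (∫ ω, X i ω * X i ω ∂μ) ≤ seqIntdim b X μ := by
    simp only [← pow_two]
    exact le_ciSup (f := fun i => intdim b (∫ ω, X i ω ^ 2 ∂μ)) (Set.finite_range _).bddAbove i
  calc _ ≤ opTrace b (∫ ω, X i ω * X i ω ∂μ) :=
        hsum.sum_le_tsum s fun j _ => hpos.re_inner_nonneg_right _
    _ ≤ intdim b (∫ ω, X i ω * X i ω ∂μ) * ‖∫ ω, X i ω * X i ω ∂μ‖ :=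
        opTrace_le_intdim_mul_norm b _
    _ ≤ _ := by gcongr

lemma sum_integral_norm_sum_apply_sq_le (hX : IsCenteredFamily μ M X) (b : HilbertBasis ι 𝕜 H)
    (hne : ∃ i, ∫ ω, X i ω * X i ω ∂μ ≠ 0) (K : Finset (Fin N)) (s : Finset ι) :
    ∑ j ∈ s, ∫ ω, ‖(∑ i ∈ K, X i ω) (b j)‖ ^ 2 ∂μ
      ≤ K.card * (K.card * (seqIntdim b X μ * blockVariance X μ)) := by
  have hint : ∀ i j, Integrable (fun ω => ‖X i ω (b j)‖ ^ 2) μ := fun i j =>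
    integrable_norm_apply_sq (hX.isSelfAdjoint i) (hX.integrable_mul_self b i) _
  calc _ ≤ ∑ j ∈ s, K.card * ∑ i ∈ K, ∫ ω, ‖X i ω (b j)‖ ^ 2 ∂μ := by
        refine Finset.sum_le_sum fun j _ => ?_
        rw [← integral_finsetSum K fun i _ => hint i j, ← integral_const_mul]
        refine integral_mono
          (integrable_norm_apply_sq (hX.isSelfAdjoint_sum K) (hX.integrable_sum_mul_self b K) _)
          ((integrable_finsetSum K fun i _ => hint i j).const_mul _) fun ω => ?_
        simp only [sum_apply]
        exact (pow_le_pow_left₀ (norm_nonneg _) (norm_sum_le K fun i => X i ω (b j)) 2).trans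
          sq_sum_le_card_mul_sum_sq
    _ = K.card * ∑ i ∈ K, ∑ j ∈ s, ∫ ω, ‖X i ω (b j)‖ ^ 2 ∂μ := by
        rw [← Finset.mul_sum, Finset.sum_comm]
    _ ≤ K.card * ∑ i ∈ K, seqIntdim b X μ * blockVariance X μ := by
        gcongr with i _
        exact hX.sum_integral_norm_apply_sq_le b hne i s
    _ = _ := by rw [Finset.sum_const, nsmul_eq_mul]

/-- The compressed and rescaled sum over at most `k` members of a centred family. -/
lemma isCenteredBlock [IsProbabilityMeasure μ] (hX : IsCenteredFamily μ M X) (b : HilbertBasis ι 𝕜 H)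
    (hne : ∃ i, ∫ ω, X i ω * X i ω ∂μ ≠ 0) (hM : 0 ≤ M) {θ : ℝ} (hθ : 0 ≤ θ)
    {K : Finset (Fin N)} {k : ℕ} (hK : K.card ≤ k) (s : Finset ι) :
    IsCenteredBlock b s μ (θ * (k * M)) (θ ^ 2 * (k * blockVariance X μ))
      (θ ^ 2 * (k * (k * (seqIntdim b X μ * blockVariance X μ))))
      (fun ω => θ • compress b s (∑ i ∈ K, X i ω)) := by
  have hv0 := hX.blockVariance_nonneg b hne
  have hd0 := zero_le_one.trans (hX.one_le_seqIntdim b hne)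
  have hKr : (K.card : ℝ) ≤ k := by exact_mod_cast hK
  have hm := hX.stronglyMeasurable_sum K
  have hs := hX.isSelfAdjoint_sum K
  have hi := hX.integrable_sum b K
  have hsq := hX.integrable_sum_mul_self b K
  have hn := integrable_norm_sq_sum K (fun i _ => hX.stronglyMeasurable i)
    fun i _ => hX.integrable_norm_sq b i
  have hcm : StronglyMeasurable fun ω => θ • compress b s (∑ i ∈ K, X i ω) :=
    ((continuous_compress b s).comp_stronglyMeasurable hm).const_smul θ
  have hcs : ∀ ω, IsSelfAdjoint (θ • compress b s (∑ i ∈ K, X i ω)) := fun ω =>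
    (compress_isSelfAdjoint (⇑b) s (hs ω)).real_smul θ
  have hlin : ∀ a : H →L[𝕜] H, ((ContinuousLinearMap.mul ℝ (H →L[𝕜] H)).flip (finProj 𝕜 b s) ∘L
      ContinuousLinearMap.mul ℝ (H →L[𝕜] H) (finProj 𝕜 b s)) a = compress b s a := fun a => rfl
  have hci : Integrable (fun ω => compress b s (∑ i ∈ K, X i ω)) μ := by
    simpa only [hlin] using ContinuousLinearMap.integrable_comp
      ((ContinuousLinearMap.mul ℝ (H →L[𝕜] H)).flip (finProj 𝕜 b s) ∘L
        ContinuousLinearMap.mul ℝ (H →L[𝕜] H) (finProj 𝕜 b s)) hi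
  have hle : ∀ ω x, ‖(θ • compress b s (∑ i ∈ K, X i ω)) x‖ ^ 2
      ≤ θ ^ 2 * ‖(∑ i ∈ K, X i ω) (finProj 𝕜 b s x)‖ ^ 2 := fun ω x => by
    rw [smul_apply, norm_smul, mul_pow, Real.norm_of_nonneg hθ]
    gcongr
    exact norm_compress_apply_le b.orthonormal s _ x
  have hcn : Integrable (fun ω => ‖θ • compress b s (∑ i ∈ K, X i ω)‖ ^ 2) μ := by
    refine Integrable.mono' (hn.const_mul (θ ^ 2)) (hcm.norm.pow 2).aestronglyMeasurable
      (Filter.Eventually.of_forall fun ω => ?_)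
    rw [Real.norm_of_nonneg (by positivity), norm_smul, mul_pow, Real.norm_of_nonneg hθ]
    gcongr
    refine ContinuousLinearMap.opNorm_le_bound _ (norm_nonneg _) fun x => ?_
    refine (norm_compress_apply_le b.orthonormal s _ x).trans
      ((ContinuousLinearMap.le_opNorm _ _).trans ?_)
    gcongr
    exact norm_finProj_apply_le b.orthonormal s x
  have hcsq := _root_.integrable_mul_self hcm hcn
  have hint := fun x => integrable_norm_apply_sq hs hsq x
  have hcint := fun x => integrable_norm_apply_sq hcs hcsq x
  refine ⟨hcm, hcs, fun ω => (compress_commute b.orthonormal s _).smul_left θ, ?_, hci.smul θ, ?_,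
    hcsq, fun x => ?_, ?_⟩
  · filter_upwards [ae_re_inner_sum_le K fun i _ => hX.bound i] with ω hω x
    have h := re_inner_compress_le b.orthonormal s (by positivity) hω x
    have e := (reInnerCLM (𝕜 := 𝕜) x x).map_smul θ (compress b s (∑ i ∈ K, X i ω))
    simp only [reInnerCLM_apply, smul_eq_mul] at e
    rw [e, mul_assoc]
    gcongr
    exact h.trans (by gcongr)
  · rw [integral_smul]
    have := ContinuousLinearMap.integral_comp_comm
      ((ContinuousLinearMap.mul ℝ (H →L[𝕜] H)).flip (finProj 𝕜 b s) ∘L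
        ContinuousLinearMap.mul ℝ (H →L[𝕜] H) (finProj 𝕜 b s)) hi
    simp only [hlin] at this
    rw [this, hX.integral_sum_eq_zero b K]
    simp [compress]
  · calc _ ≤ ∫ ω, θ ^ 2 * ‖(∑ i ∈ K, X i ω) (finProj 𝕜 b s x)‖ ^ 2 ∂μ :=
          integral_mono (hcint x) ((hint _).const_mul _) fun ω => hle ω x
      _ = θ ^ 2 * ∫ ω, ‖(∑ i ∈ K, X i ω) (finProj 𝕜 b s x)‖ ^ 2 ∂μ := integral_const_mul _ _
      _ ≤ θ ^ 2 * (K.card * blockVariance X μ * ‖finProj 𝕜 b s x‖ ^ 2) := by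
          gcongr
          exact hX.integral_norm_sum_apply_sq_le b K _
      _ ≤ θ ^ 2 * (k * blockVariance X μ * ‖x‖ ^ 2) := by
          gcongr
          exact norm_finProj_apply_le b.orthonormal s x
      _ = _ := by ring
  · simp only [fun ω => finTrace_mul_self (⇑b) s (hcs ω)]
    rw [integral_finsetSum s fun j _ => hcint _]
    calc _ ≤ ∑ j ∈ s, θ ^ 2 * ∫ ω, ‖(∑ i ∈ K, X i ω) (b j)‖ ^ 2 ∂μ := by
          refine Finset.sum_le_sum fun j hj => ?_
          rw [← integral_const_mul]
          refine integral_mono (hcint _) ((hint _).const_mul _) fun ω => ?_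
          have := hle ω (b j)
          rwa [finProj_apply_mem b.orthonormal hj] at this
      _ = θ ^ 2 * ∑ j ∈ s, ∫ ω, ‖(∑ i ∈ K, X i ω) (b j)‖ ^ 2 ∂μ := by rw [Finset.mul_sum]
      _ ≤ θ ^ 2 * (K.card * (K.card * (seqIntdim b X μ * blockVariance X μ))) := by
          gcongr
          exact hX.sum_integral_norm_sum_apply_sq_le b hne K s
      _ ≤ _ := by gcongr

end IsCenteredFamily

end Families

/-! ### Blocks of a gap independent family -/

section GapBlocks

/-- The indices in the `q`-th block of length `k`. -/
def indexBlock (N k q : ℕ) : Finset (Fin N) := Finset.univ.filter fun i => (i : ℕ) / k = q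

lemma card_indexBlock_le (N : ℕ) {k : ℕ} (hk : 1 ≤ k) (q : ℕ) : (indexBlock N k q).card ≤ k := by
  have h : (indexBlock N k q).card ≤ (Finset.range k).card := by
    refine Finset.card_le_card_of_injOn (fun i => (i : ℕ) % k)
      (fun i _ => by simpa using Nat.mod_lt _ hk) fun i hi j hj hij => ?_
    simp only [indexBlock, Finset.coe_filter, Finset.mem_univ, true_and, Set.mem_ofPred_eq] at hi hj
    refine Fin.ext ?_
    rw [← Nat.div_add_mod (i : ℕ) k, ← Nat.div_add_mod (j : ℕ) k, hi, hj]
    simp only at hij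
    rw [hij]
  simpa using h

lemma sum_range_eq_even_add_odd {E : Type*} [AddCommMonoid E] (f : ℕ → E) (n : ℕ) :
    ∑ q ∈ Finset.range n, f q = ∑ r ∈ Finset.range ((n + 1) / 2), f (2 * r)
      + ∑ r ∈ Finset.range (n / 2), f (2 * r + 1) := by
  induction n with
  | zero => simp
  | succ n ih =>
    rw [Finset.sum_range_succ, ih]
    obtain ⟨a, rfl | rfl⟩ := n.even_or_odd'
    · rw [show (2 * a + 1 + 1) / 2 = a + 1 by omega, show (2 * a + 1) / 2 = a by omega,
        show 2 * a / 2 = a by omega, Finset.sum_range_succ]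
      exact add_right_comm _ _ _
    · rw [show (2 * a + 1 + 1 + 1) / 2 = a + 1 by omega, show (2 * a + 1 + 1) / 2 = a + 1 by omega,
        show (2 * a + 1) / 2 = a by omega, Finset.sum_range_succ (fun r => f (2 * r + 1)), add_assoc]

lemma sum_eq_sum_indexBlock {E : Type*} [AddCommMonoid E] {n k : ℕ} (f : Fin (n * k) → E) :
    ∑ i, f i = ∑ q ∈ Finset.range n, ∑ i ∈ indexBlock (n * k) k q, f i := by
  refine (Finset.sum_fiberwise_of_maps_to (fun i _ => ?_) f).symm
  exact Finset.mem_range.2 (Nat.div_lt_of_lt_mul (by simp [mul_comm k n]))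

variable {Ω E : Type*} [MeasurableSpace Ω] [TopologicalSpace E]
  [TopologicalSpace.PseudoMetrizableSpace E] [MeasurableSpace E] [BorelSpace E]

lemma stronglyMeasurable_comap {f : Ω → E} (hf : StronglyMeasurable f) :
    StronglyMeasurable[MeasurableSpace.comap f inferInstance] f :=
  (@stronglyMeasurable_iff_measurable_separable _ _ f (MeasurableSpace.comap f inferInstance)
    _ _ _ _).2 ⟨comap_measurable f,
      (stronglyMeasurable_iff_measurable_separable.1 hf).2⟩

lemma stronglyMeasurable_sum_iSup_comap [AddCommMonoid E] [ContinuousAdd E] {N : ℕ}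
    {X : Fin N → Ω → E} (hX : ∀ i, StronglyMeasurable (X i)) {p : Fin N → Prop}
    {K : Finset (Fin N)} (hK : ∀ i ∈ K, p i) :
    StronglyMeasurable[⨆ (j : Fin N) (_ : p j), MeasurableSpace.comap (X j) inferInstance]
      fun ω => ∑ i ∈ K, X i ω := by
  refine Finset.stronglyMeasurable_fun_sum K fun i hi => ?_
  exact (stronglyMeasurable_comap (hX i)).mono
    (le_iSup₂_of_le (f := fun j (_ : p j) => MeasurableSpace.comap (X j) inferInstance) i (hK i hi)
      le_rfl)

/-- Every other block of length `k` of a `k`-gap independent family is independent of the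
preceding ones: the gap between them is a whole block. -/
lemma GapIndependent.indepFun_sum_range [AddCommMonoid E] [ContinuousAdd E] {N k : ℕ}
    {X : Fin N → Ω → E} {μ : Measure Ω} [IsProbabilityMeasure μ] (hgap : GapIndependent k X μ)
    (hX : ∀ i, StronglyMeasurable (X i)) (hk : 1 ≤ k) {g : E → E} (hg : Continuous g) (e r : ℕ) :
    IndepFun (fun ω => ∑ j ∈ Finset.range r, g (∑ i ∈ indexBlock N k (2 * j + e), X i ω))
      (fun ω => g (∑ i ∈ indexBlock N k (2 * r + e), X i ω)) μ := by
  rcases Nat.eq_zero_or_pos r with rfl | hr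
  · simpa using indepFun_const_left (0 : E) _
  -- the last index of the preceding block of the same parity
  set m := (2 * r + e - 1) * k - 1 with hm
  have hpos : 1 ≤ (2 * r + e - 1) * k := Nat.mul_pos (by omega) hk
  have hmk : m + k + 1 = (2 * r + e) * k := by
    have : (2 * r + e) * k = (2 * r + e - 1) * k + k := by
      conv_lhs => rw [show 2 * r + e = (2 * r + e - 1) + 1 by omega, add_mul, one_mul]
    omega
  have hpast : ∀ j ∈ Finset.range r, ∀ i ∈ indexBlock N k (2 * j + e), (i : ℕ) ≤ m := by
    intro j hj i hi
    have hi' : (i : ℕ) / k = 2 * j + e := by simpa [indexBlock] using hi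
    have hlt : (i : ℕ) < (2 * r + e - 1) * k := by
      rw [← Nat.div_lt_iff_lt_mul hk, hi']
      have := Finset.mem_range.1 hj
      omega
    omega
  have hfut : ∀ i ∈ indexBlock N k (2 * r + e), m + k ≤ (i : ℕ) := by
    intro i hi
    have hi' : (i : ℕ) / k = 2 * r + e := by simpa [indexBlock] using hi
    have : (2 * r + e) * k ≤ (i : ℕ) := by
      rw [← hi']; exact Nat.div_mul_le_self _ _
    omega
  refine (IndepFun_iff_Indep _ _ _).2 (indep_of_indep_of_le_left
    (indep_of_indep_of_le_right (hgap m) ?_) ?_)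
  · exact (hg.comp_stronglyMeasurable
      (stronglyMeasurable_sum_iSup_comap hX (p := fun i => m + k ≤ (i : ℕ)) hfut)).measurable.comap_le
  · refine StronglyMeasurable.measurable ?_ |>.comap_le
    refine Finset.stronglyMeasurable_fun_sum _ fun j hj => ?_
    exact hg.comp_stronglyMeasurable
      (stronglyMeasurable_sum_iSup_comap hX (p := fun i => (i : ℕ) ≤ m) (hpast j hj))

end GapBlocks

/-! ### The trace moment of the sum -/

section TraceMoment

lemma two_mul_le_three_of_mul_log_lt_one {x : ℝ} {n : ℕ} (hn : 2 ≤ n) (hx : 0 ≤ x) (h : x * Real.log n < 1) :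
    2 * x ≤ 3 := by
  have h2 : Real.log 2 ≤ Real.log n :=
    Real.log_le_log two_pos (by exact_mod_cast hn)
  have h3 := Real.log_two_gt_d9
  nlinarith

/-- The numerical comparison. Here `x = t M k`, and `x < 1 / log 2` gives `4 exp (2 x) ≤ 169`. -/
lemma recursion_bound_le {n k : ℕ} (hn : 2 ≤ n) {t x d V : ℝ} (hx : 0 ≤ x)
    (hxn : x * Real.log n < 1) (hd : 0 ≤ d) (hV : 0 ≤ V) :
    n * (Real.exp (2 * x) / 2 * ((2 * t) ^ 2 * (k * (k * (d * V)))))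
        * (1 + Real.exp (2 * x) / 2 * ((2 * t) ^ 2 * (k * V))) ^ n / 2
      ≤ (n * k : ℝ) / 2 * d
        * Real.exp (t ^ 2 * (n * k : ℝ) * V * (169 / (1 - x * Real.log n))) := by
  set y := Real.exp (2 * x) / 2 * ((2 * t) ^ 2 * (k * V)) with hy
  have hy0 : 0 ≤ y := by positivity
  have hn1 : (1 : ℝ) ≤ n := by exact_mod_cast (by omega : 1 ≤ n)
  have hlog : 0 ≤ Real.log n := Real.log_nonneg hn1
  have hexp : Real.exp (2 * x) ≤ 42 := by
    calc Real.exp (2 * x) ≤ Real.exp 3 := Real.exp_le_exp.2 (two_mul_le_three_of_mul_log_lt_one hn hx hxn)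
      _ = Real.exp 1 ^ 3 := by rw [← Real.exp_nat_mul]; norm_num
      _ ≤ 2.7182818286 ^ 3 := by
          gcongr
          exact Real.exp_one_lt_d9.le
      _ ≤ 42 := by norm_num
  have h1 : y ≤ Real.exp y := by linarith [Real.add_one_le_exp y]
  have h2 : (1 + y) ^ n ≤ Real.exp (n * y) := by
    rw [Real.exp_nat_mul]
    gcongr
    linarith [Real.add_one_le_exp y]
  have h3 : y + n * y ≤ t ^ 2 * (n * k : ℝ) * V * (169 / (1 - x * Real.log n)) := by
    have hq : 169 ≤ 169 / (1 - x * Real.log n) := by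
      rw [le_div_iff₀ (by linarith)]
      nlinarith [mul_nonneg hx hlog]
    calc y + n * y ≤ 2 * (n * y) := by nlinarith
      _ = t ^ 2 * (n * k : ℝ) * V * (4 * Real.exp (2 * x)) := by rw [hy]; ring
      _ ≤ t ^ 2 * (n * k : ℝ) * V * (169 / (1 - x * Real.log n)) := by
          gcongr
          linarith
  calc _ = (n * k : ℝ) / 2 * d * (y * (1 + y) ^ n) := by rw [hy]; ring
    _ ≤ (n * k : ℝ) / 2 * d * (Real.exp y * Real.exp (n * y)) := by gcongr
    _ = (n * k : ℝ) / 2 * d * Real.exp (y + n * y) := by rw [Real.exp_add]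
    _ ≤ _ := by gcongr

variable {Ω ι 𝕜 H : Type*} [MeasurableSpace Ω] [RCLike 𝕜] [NormedAddCommGroup H]
  [InnerProductSpace 𝕜 H] [NormedSpace ℝ H] [IsScalarTower ℝ 𝕜 H] [CompleteSpace H]
  {μ : Measure Ω} [IsProbabilityMeasure μ] {M : ℝ} {n k : ℕ} {X : Fin (n * k) → Ω → H →L[𝕜] H}

namespace IsCenteredFamily

lemma integrable_exp_compress (hX : IsCenteredFamily μ M X) (b : HilbertBasis ι 𝕜 H)
    (hM : 0 ≤ M) {t : ℝ} (ht : 0 ≤ t) (s : Finset ι) (K : Finset (Fin (n * k))) :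
    Integrable (fun ω => NormedSpace.exp (t • compress b s (∑ i ∈ K, X i ω))) μ := by
  refine integrable_exp_of_re_inner_le (c := t * (K.card * M))
    (((continuous_compress (⇑b) s).comp_stronglyMeasurable (hX.stronglyMeasurable_sum K)).const_smul
      t)
    (fun ω => (compress_isSelfAdjoint (⇑b) s (hX.isSelfAdjoint_sum K ω)).real_smul t) ?_
  filter_upwards [ae_re_inner_sum_le K fun i _ => hX.bound i] with ω hω x
  have h := re_inner_compress_le b.orthonormal s (by positivity) hω x
  have e := (reInnerCLM (𝕜 := 𝕜) x x).map_smul t (compress b s (∑ i ∈ K, X i ω))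
  simp only [reInnerCLM_apply, smul_eq_mul] at e
  rw [e, mul_assoc]
  gcongr

variable [Countable ι]

/-- The bound of the trace moment for the sum of every other block. -/
lemma integral_finTrace_exp_blocks_le (hX : IsCenteredFamily μ M X) (b : HilbertBasis ι 𝕜 H)
    (hne : ∃ i, ∫ ω, X i ω * X i ω ∂μ ≠ 0) (hgap : GapIndependent k X μ) (hM : 0 ≤ M)
    (hk : 1 ≤ k) {θ : ℝ} (hθ : 0 ≤ θ) (s : Finset ι) (e m : ℕ) :
    ∫ ω, finTrace b s (NormedSpace.exp (∑ j ∈ Finset.range m,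
        θ • compress b s (∑ i ∈ indexBlock (n * k) k (2 * j + e), X i ω))) ∂μ
        - finTrace b s (1 : H →L[𝕜] H)
      ≤ m * (Real.exp (θ * (k * M)) / 2
          * (θ ^ 2 * (k * (k * (seqIntdim b X μ * blockVariance X μ)))))
        * (1 + Real.exp (θ * (k * M)) / 2 * (θ ^ 2 * (k * blockVariance X μ))) ^ m := by
  have hv0 := hX.blockVariance_nonneg b hne
  have hd0 := zero_le_one.trans (hX.one_le_seqIntdim b hne)
  exact integral_finTrace_exp_sum_le b.orthonormal
    (A := fun j ω => θ • compress b s (∑ i ∈ indexBlock (n * k) k (2 * j + e), X i ω))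
    (fun j _ => hX.isCenteredBlock b hne hM hθ (card_indexBlock_le _ hk _) s)
    (by positivity) (by positivity) (by positivity)
    fun j _ => hgap.indepFun_sum_range hX.stronglyMeasurable hk
      ((continuous_compress (⇑b) s).const_smul θ) e j

lemma integral_finTrace_exp_compress_le (hX : IsCenteredFamily μ M X) (b : HilbertBasis ι 𝕜 H)
    (hne : ∃ i, ∫ ω, X i ω * X i ω ∂μ ≠ 0) (hgap : GapIndependent k X μ) (hM : 0 ≤ M)
    (hn : 2 ≤ n) (hk : 1 ≤ k) {t : ℝ} (ht : 0 ≤ t) (htM : t * M * k * Real.log n < 1)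
    (s : Finset ι) :
    ∫ ω, finTrace b s (NormedSpace.exp (t • compress b s (∑ i, X i ω))) ∂μ
        - finTrace b s (1 : H →L[𝕜] H)
      ≤ (n * k : ℝ) / 2 * seqIntdim b X μ * Real.exp (t ^ 2 * (n * k : ℝ) * blockVariance X μ
          * (169 / (1 - t * M * k * Real.log n))) := by
  have hv0 := hX.blockVariance_nonneg b hne
  have hd0 := zero_le_one.trans (hX.one_le_seqIntdim b hne)
  refine le_trans ?_ (recursion_bound_le hn (by positivity) htM hd0 hv0)
  have hc : 2 * (t * M * k) = 2 * t * (k * M) := by ring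
  rw [hc]
  set y := Real.exp (2 * t * (k * M)) / 2
    * ((2 * t) ^ 2 * (k * (k * (seqIntdim b X μ * blockVariance X μ)))) with hy
  set q := 1 + Real.exp (2 * t * (k * M)) / 2 * ((2 * t) ^ 2 * (k * blockVariance X μ)) with hq
  have hy0 : 0 ≤ y := by positivity
  have hq1 : 1 ≤ q := le_add_of_nonneg_right (by positivity)
  -- the sums over the blocks of each parity
  let S : ℕ → ℕ → Ω → H →L[𝕜] H := fun e m ω => ∑ j ∈ Finset.range m,
    compress b s (∑ i ∈ indexBlock (n * k) k (2 * j + e), X i ω)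
  have hS : ∀ e m, ∫ ω, finTrace b s (NormedSpace.exp ((2 : ℝ) • t • S e m ω)) ∂μ
      - finTrace b s (1 : H →L[𝕜] H) ≤ m * y * q ^ m := fun e m => by
    have h := hX.integral_finTrace_exp_blocks_le b hne hgap hM hk (θ := 2 * t) (by positivity) s e m
    simpa only [S, Finset.smul_sum, smul_smul] using h
  have hSsa : ∀ e m ω, IsSelfAdjoint (S e m ω) := fun e m ω =>
    _root_.isSelfAdjoint_sum _ fun j _ => compress_isSelfAdjoint _ s (hX.isSelfAdjoint_sum _ ω)
  have hScomm : ∀ e m ω, Commute (S e m ω) (finProj 𝕜 b s) := fun e m ω =>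
    Commute.sum_left _ _ _ fun j _ => compress_commute b.orthonormal s _
  have hSint : ∀ e m, Integrable (fun ω =>
      finTrace b s (NormedSpace.exp ((2 : ℝ) • t • S e m ω))) μ := fun e m => by
    refine (finTrace (⇑b) s).integrable_comp (integrable_exp_of_re_inner_le
      (c := m * (2 * t * (k * M))) ?_ (fun ω => ((hSsa e m ω).real_smul t).real_smul 2) ?_)
    · refine ((Finset.stronglyMeasurable_fun_sum _ fun j _ => ?_).const_smul t).const_smul (2 : ℝ)
      exact (continuous_compress (⇑b) s).comp_stronglyMeasurable (hX.stronglyMeasurable_sum _)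
    · have := ae_re_inner_sum_le (Finset.range m) fun j _ => (hX.isCenteredBlock b hne hM
        (θ := 2 * t) (by positivity) (card_indexBlock_le _ hk (2 * j + e)) s).bound
      simpa only [S, Finset.smul_sum, smul_smul, Finset.card_range] using this
  have hsplit : ∀ ω, t • compress b s (∑ i, X i ω)
      = t • S 0 ((n + 1) / 2) ω + t • S 1 (n / 2) ω := fun ω => by
    rw [← smul_add, sum_eq_sum_indexBlock, compress_sum, sum_range_eq_even_add_odd]
    rfl
  have hm : (((n + 1) / 2 : ℕ) : ℝ) + ((n / 2 : ℕ) : ℝ) = n := by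
    exact_mod_cast (by omega : (n + 1) / 2 + n / 2 = n)
  have hpow : ∀ m ≤ n, q ^ m ≤ q ^ n := fun m hmn => pow_le_pow_right₀ hq1 hmn
  have hGT : ∫ ω, finTrace b s (NormedSpace.exp (t • compress b s (∑ i, X i ω))) ∂μ
      ≤ ∫ ω, (finTrace b s (NormedSpace.exp ((2 : ℝ) • t • S 0 ((n + 1) / 2) ω))
        + finTrace b s (NormedSpace.exp ((2 : ℝ) • t • S 1 (n / 2) ω))) / 2 ∂μ := by
    refine integral_mono
      ((finTrace (⇑b) s).integrable_comp (hX.integrable_exp_compress b hM ht s Finset.univ))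
      (((hSint _ _).add (hSint _ _)).div_const 2) fun ω => ?_
    simp only [hsplit]
    exact finTrace_exp_add_le_half_add b.orthonormal ((hSsa _ _ ω).real_smul t)
      ((hSsa _ _ ω).real_smul t) ((hScomm _ _ ω).smul_left t) ((hScomm _ _ ω).smul_left t)
  rw [integral_div, integral_add (hSint _ _) (hSint _ _)] at hGT
  have h0 := (hS 0 ((n + 1) / 2)).trans
    (mul_le_mul_of_nonneg_left (hpow _ (by omega)) (by positivity))
  have h1 := (hS 1 (n / 2)).trans (mul_le_mul_of_nonneg_left (hpow _ (by omega)) (by positivity))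
  have hadd : (n : ℝ) * y * q ^ n
      = ((n + 1) / 2 : ℕ) * y * q ^ n + (n / 2 : ℕ) * y * q ^ n := by
    rw [← hm]; ring
  linarith

/-- Passing from the finite compressions to the whole space: partial traces of
`E [exp (t ∑ X_i) - 1]` are limits of partial traces of its compressed versions. -/
lemma sum_re_inner_integral_exp_le (hX : IsCenteredFamily μ M X) (b : HilbertBasis ι 𝕜 H)
    (hne : ∃ i, ∫ ω, X i ω * X i ω ∂μ ≠ 0) (hgap : GapIndependent k X μ) (hM : 0 ≤ M)
    (hn : 2 ≤ n) (hk : 1 ≤ k) {t : ℝ} (ht : 0 ≤ t) (htM : t * M * k * Real.log n < 1)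
    (F : Finset ι) :
    ∑ j ∈ F, RCLike.re (inner 𝕜 (b j) (((∫ ω, NormedSpace.exp (t • ∑ i, X i ω) ∂μ) - 1) (b j)))
      ≤ (n * k : ℝ) / 2 * seqIntdim b X μ * Real.exp (t ^ 2 * (n * k : ℝ) * blockVariance X μ
          * (169 / (1 - t * M * k * Real.log n))) := by
  classical
  let : NormedAlgebra ℚ (H →L[𝕜] H) := .restrictScalars ℚ ℝ _
  rw [← finTrace_apply]
  have hlim : Filter.Tendsto
      (fun s : Finset ι => ∫ ω, NormedSpace.exp (t • compress b s (∑ i, X i ω)) ∂μ) Filter.atTop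
      (nhds (∫ ω, NormedSpace.exp (t • ∑ i, X i ω) ∂μ)) := by
    refine tendsto_integral_filter_of_dominated_convergence
      (fun _ => Real.exp (t * ((Finset.univ : Finset (Fin (n * k))).card * M)))
      (Filter.Eventually.of_forall fun s =>
        (hX.integrable_exp_compress b hM ht s Finset.univ).aestronglyMeasurable)
      (Filter.Eventually.of_forall fun s => ?_) (integrable_const _)
      (Filter.Eventually.of_forall fun ω => ?_)
    · filter_upwards [ae_re_inner_sum_le Finset.univ fun i _ => hX.bound i] with ω hω
      refine norm_exp_le_of_re_inner_le
        ((compress_isSelfAdjoint (⇑b) s (hX.isSelfAdjoint_sum Finset.univ ω)).real_smul t)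
        fun x => ?_
      have h := re_inner_compress_le b.orthonormal s (by positivity) hω x
      have e := (reInnerCLM (𝕜 := 𝕜) x x).map_smul t (compress b s (∑ i, X i ω))
      simp only [reInnerCLM_apply, smul_eq_mul] at e
      rw [e, mul_assoc]
      gcongr
    · refine (NormedSpace.exp_continuous.tendsto _).comp ((tendsto_compress b
        (hX.isSelfAdjoint_sum Finset.univ ω) ?_).const_smul t)
      have hsum : Summable fun j => (Fintype.card (Fin (n * k)) : ℝ)
          * ∑ i, ‖X i ω (b j)‖ ^ 2 :=
        (summable_sum fun i _ => summable_norm_sq_of_hsNormSq_lt_top b.orthonormal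
          (hX.hsNormSq_lt_top i ω)).mul_left _
      refine hsum.of_nonneg_of_le (fun j => by positivity) fun j => ?_
      rw [sum_apply]
      exact (pow_le_pow_left₀ (norm_nonneg _) (norm_sum_le _ fun i => X i ω (b j)) 2).trans
        sq_sum_le_card_mul_sum_sq
  refine le_of_tendsto (((finTrace (⇑b) F).continuous.tendsto _).comp
    (hlim.sub_const (1 : H →L[𝕜] H))) ?_
  filter_upwards [Filter.eventually_ge_atTop F] with s hs
  refine le_trans ?_ (hX.integral_finTrace_exp_compress_le b hne hgap hM hn hk ht htM s)
  have hI := hX.integrable_exp_compress b hM ht s Finset.univ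
  rw [(finTrace (⇑b) s).integral_comp_comm hI, ← map_sub, Function.comp_apply, finTrace_apply,
    finTrace_apply]
  refine Finset.sum_le_sum_of_subset_of_nonneg hs fun j _ _ => ?_
  have hci : Integrable (fun ω => compress b s (∑ i, X i ω)) μ ∧
      ∫ ω, compress b s (∑ i, X i ω) ∂μ = 0 := by
    have h := hX.isCenteredBlock b hne hM zero_le_one (K := Finset.univ) le_rfl s
    simp only [one_smul] at h
    exact ⟨h.integrable, h.integral_eq_zero⟩
  refine (isPositive_integral_exp_sub_one (hci.1.smul t) ?_ (fun ω =>
    (compress_isSelfAdjoint (⇑b) s (hX.isSelfAdjoint_sum Finset.univ ω)).real_smul t)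
    hI).re_inner_nonneg_right _
  simp only [Pi.smul_apply]
  rw [integral_smul, hci.2, smul_zero]

end IsCenteredFamily

end TraceMoment

/-! ### Integrability of the trace and conclusion -/

section Conclusion

/-- If the trace norm is integrable, then the trace of the expectation is the expectation of the
trace, by Fubini's theorem for the diagonal entries. -/
lemma integrable_opTrace_and_integral_eq {Ω ι 𝕜 H : Type*} [MeasurableSpace Ω] {μ : Measure Ω}
    [RCLike 𝕜] [NormedAddCommGroup H] [InnerProductSpace 𝕜 H] [NormedSpace ℝ H]
    [IsScalarTower ℝ 𝕜 H] [CompleteSpace H] [Countable ι] (b : HilbertBasis ι 𝕜 H)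
    {f : Ω → H →L[𝕜] H} (hf : Integrable f μ) (htr : ∫⁻ ω, traceNorm (f ω) ∂μ < ⊤) :
    Integrable (fun ω => opTrace b (f ω)) μ ∧
      ∫ ω, opTrace b (f ω) ∂μ = opTrace b (∫ ω, f ω ∂μ) := by
  have hint : ∀ j, Integrable (fun ω => RCLike.re (inner 𝕜 (b j) (f ω (b j)))) μ := fun j =>
    integrable_re_inner hf _ _
  have hpt : ∀ ω, ∑' j, ‖RCLike.re (inner 𝕜 (b j) (f ω (b j)))‖ₑ ≤ traceNorm (f ω) := fun ω => by
    refine ENNReal.summable.tsum_le_of_sum_le fun F => ?_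
    refine (Finset.sum_le_sum fun j _ => ?_).trans
      (sum_enorm_inner_le_traceNorm b.orthonormal (f ω) F)
    rw [← ofReal_norm, ← ofReal_norm]
    exact ENNReal.ofReal_le_ofReal (RCLike.abs_re_le_norm _)
  have hlt : ∑' j, ∫⁻ ω, ‖RCLike.re (inner 𝕜 (b j) (f ω (b j)))‖ₑ ∂μ < ⊤ := by
    rw [← lintegral_tsum fun j => (hint j).aestronglyMeasurable.enorm]
    exact (lintegral_mono hpt).trans_lt htr
  have hsum : Summable fun j => ∫ ω, ‖RCLike.re (inner 𝕜 (b j) (f ω (b j)))‖ ∂μ := by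
    refine (ENNReal.summable_toReal hlt.ne).congr fun j => ?_
    rw [integral_norm_eq_lintegral_enorm (hint j).aestronglyMeasurable]
  have hsummable : ∀ᵐ ω ∂μ, Summable fun j => RCLike.re (inner 𝕜 (b j) (f ω (b j))) := by
    have h : ∀ᵐ ω ∂μ, ∑' j, ‖RCLike.re (inner 𝕜 (b j) (f ω (b j)))‖ₑ < ⊤ := by
      refine ae_lt_top' (AEMeasurable.tsum fun j => (hint j).aestronglyMeasurable.enorm) ?_
      rw [lintegral_tsum fun j => (hint j).aestronglyMeasurable.enorm]
      exact hlt.ne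
    filter_upwards [h] with ω hω
    exact Summable.of_norm (by simpa using ENNReal.summable_toReal hω.ne)
  refine ⟨⟨?_, ?_⟩, ?_⟩
  · refine aestronglyMeasurable_of_tendsto_ae Filter.atTop
      (f := fun (F : Finset ι) ω => ∑ j ∈ F, RCLike.re (inner 𝕜 (b j) (f ω (b j))))
      (fun F => (integrable_finsetSum F fun j _ => hint j).aestronglyMeasurable) ?_
    filter_upwards [hsummable] with ω hω
    exact hω.hasSum
  · refine (lintegral_mono fun ω => ?_).trans_lt htr
    exact (enorm_tsum_le_tsum_enorm).trans (hpt ω)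
  · refine (hasSum_integral_of_summable_integral_norm hint hsum).tsum_eq.symm.trans ?_
    exact tsum_congr fun j => (re_inner_integral hf _ _).symm

lemma log_le_log_add_of_le_mul_exp {T p q r : ℝ} (hT : 0 ≤ T) (hp : 1 ≤ p) (hq : 0 ≤ q)
    (hr : 0 ≤ r) (h : T ≤ p * Real.exp q) : Real.log T ≤ r + Real.log p + q := by
  rcases hT.eq_or_lt with rfl | hT
  · rw [Real.log_zero]
    have := Real.log_nonneg hp
    positivity
  · have h1 := Real.log_le_log hT h
    rw [Real.log_mul (by positivity) (Real.exp_ne_zero _), Real.log_exp] at h1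
    linarith

end Conclusion

theorem lemma5p1 {Ω ι 𝕜 H : Type*} [MeasurableSpace Ω] (μ : Measure Ω) [IsProbabilityMeasure μ]
    [RCLike 𝕜] [NormedAddCommGroup H] [InnerProductSpace 𝕜 H] [NormedSpace ℝ H]
    [IsScalarTower ℝ 𝕜 H] [CompleteSpace H] [TopologicalSpace.SeparableSpace H]
    (b : HilbertBasis ι 𝕜 H)
    (n k : ℕ) (hn : 2 ≤ n) (hk : 1 ≤ k)
    (X : Fin (n * k) → Ω → H →L[𝕜] H)
    (hmeas : ∀ i, StronglyMeasurable (X i))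
    (hself : ∀ i ω, IsSelfAdjoint (X i ω))
    (hHS : ∀ i ω, hsNormSq (X i ω) < ⊤)
    (hL2 : ∀ i, ∫⁻ ω, hsNormSq (X i ω) ∂μ < ⊤)
    (hne : ∃ i, ∫ ω, X i ω ^ 2 ∂μ ≠ 0)
    (hgap : GapIndependent k X μ)
    (M : ℝ) (hM : 0 < M)
    (hmean : ∀ i, ∫ ω, X i ω ∂μ = 0)
    (hbound : ∀ i, ∀ᵐ ω ∂μ, lambdaMax (X i ω) ≤ M)
    (t : ℝ) (ht : 0 < t) (htM : t * M < 1 / (k : ℝ) * (1 / Real.log n)) :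
    -- `E[exp(t ∑ X_i) - I]` is a positive operator of trace class, and its trace obeys the bound
    ((∫ ω, (NormedSpace.exp (t • ∑ i, X i ω) - 1) ∂μ).IsPositive ∧
      Summable (fun j => RCLike.re
        (inner 𝕜 (b j) ((∫ ω, (NormedSpace.exp (t • ∑ i, X i ω) - 1) ∂μ) (b j)))) ∧
      Real.log (opTrace b (∫ ω, (NormedSpace.exp (t • ∑ i, X i ω) - 1) ∂μ)) ≤
        Real.log n * Real.log 3 + Real.log ((n * k : ℝ) / 2 * seqIntdim b X μ)
          + t ^ 2 * (n * k : ℝ) * blockVariance X μ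
            * (169 / (1 - t * M * k * Real.log n))) ∧
    -- whenever `exp(t ∑ X_i) - I` has an integrable trace norm, its trace is integrable, and the
    -- expectation of the trace obeys the bound
    (∫⁻ ω, traceNorm (NormedSpace.exp (t • ∑ i, X i ω) - 1) ∂μ < ⊤ →
      Integrable (fun ω => opTrace b (NormedSpace.exp (t • ∑ i, X i ω) - 1)) μ ∧
      Real.log (∫ ω, opTrace b (NormedSpace.exp (t • ∑ i, X i ω) - 1) ∂μ) ≤
        Real.log n * Real.log 3 + Real.log ((n * k : ℝ) / 2 * seqIntdim b X μ)
          + t ^ 2 * (n * k : ℝ) * blockVariance X μ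
            * (169 / (1 - t * M * k * Real.log n))) := by
  have hι : Countable ι := b.countable_of_separableSpace
  have hX : IsCenteredFamily μ M X := ⟨hmeas, hself, hHS, hL2, hmean, fun i => by
    filter_upwards [hbound i] with ω hω x
    exact (re_inner_le_lambdaMax _ x).trans (by gcongr)⟩
  have hne' : ∃ i, ∫ ω, X i ω * X i ω ∂μ ≠ 0 := by simpa only [pow_two] using hne
  have hn1 : (1 : ℝ) < n := by exact_mod_cast hn
  have hk1 : (1 : ℝ) ≤ k := by exact_mod_cast hk
  have hlog : 0 < Real.log n := Real.log_pos hn1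
  have htM' : t * M * k * Real.log n < 1 := by
    have hkl : 0 < (k : ℝ) * Real.log n := by positivity
    rw [one_div_mul_one_div, lt_div_iff₀ hkl] at htM
    linarith
  have hSsa : ∀ ω, IsSelfAdjoint (t • ∑ i, X i ω) := fun ω =>
    (hX.isSelfAdjoint_sum Finset.univ ω).real_smul t
  have hSi : Integrable (fun ω => t • ∑ i, X i ω) μ := (hX.integrable_sum b Finset.univ).smul t
  have hS0 : ∫ ω, t • ∑ i, X i ω ∂μ = 0 := by
    rw [integral_smul, hX.integral_sum_eq_zero b Finset.univ, smul_zero]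
  have he : Integrable (fun ω => NormedSpace.exp (t • ∑ i, X i ω)) μ := by
    refine integrable_exp_of_re_inner_le
      (c := t * ((Finset.univ : Finset (Fin (n * k))).card * M))
      ((hX.stronglyMeasurable_sum Finset.univ).const_smul t) hSsa ?_
    filter_upwards [ae_re_inner_sum_le Finset.univ fun i _ => hX.bound i] with ω hω x
    have e := (reInnerCLM (𝕜 := 𝕜) x x).map_smul t (∑ i, X i ω)
    simp only [reInnerCLM_apply, smul_eq_mul] at e
    rw [e, mul_assoc]
    exact mul_le_mul_of_nonneg_left (hω x) ht.le
  have heY : Integrable (fun ω => NormedSpace.exp (t • ∑ i, X i ω) - 1) μ :=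
    he.sub (integrable_const _)
  have hEY : ∫ ω, (NormedSpace.exp (t • ∑ i, X i ω) - 1) ∂μ
      = (∫ ω, NormedSpace.exp (t • ∑ i, X i ω) ∂μ) - 1 := by
    rw [integral_sub he (integrable_const _)]; simp
  have hpos : (∫ ω, (NormedSpace.exp (t • ∑ i, X i ω) - 1) ∂μ).IsPositive := by
    rw [hEY]; exact isPositive_integral_exp_sub_one hSi hS0 hSsa he
  have hle := fun F => hX.sum_re_inner_integral_exp_le b hne' hgap hM.le hn hk ht.le htM' F
  rw [← hEY] at hle
  have hdiag := fun j => hpos.re_inner_nonneg_right (b j)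
  have hsum := summable_of_sum_le hdiag hle
  have hlogle : Real.log (opTrace b (∫ ω, (NormedSpace.exp (t • ∑ i, X i ω) - 1) ∂μ)) ≤
      Real.log n * Real.log 3 + Real.log ((n * k : ℝ) / 2 * seqIntdim b X μ)
        + t ^ 2 * (n * k : ℝ) * blockVariance X μ * (169 / (1 - t * M * k * Real.log n)) := by
    have hv0 := hX.blockVariance_nonneg b hne'
    have hd1 := hX.one_le_seqIntdim b hne'
    have hn2 : (2 : ℝ) ≤ n := by exact_mod_cast hn
    refine log_le_log_add_of_le_mul_exp (tsum_nonneg hdiag) ?_ ?_ ?_ (hsum.tsum_le_of_sum_le hle)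
    · refine one_le_mul_of_one_le_of_one_le ?_ hd1
      nlinarith
    · have : 0 < 1 - t * M * k * Real.log n := by linarith
      positivity
    · exact mul_nonneg hlog.le (Real.log_nonneg (by norm_num))
  refine ⟨⟨hpos, hsum, hlogle⟩, fun htr => ?_⟩
  obtain ⟨hint, heq⟩ := integrable_opTrace_and_integral_eq b heY htr
  exact ⟨hint, heq ▸ hlogle⟩
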